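/- An instance $I$ of the one-sided model consists of a finite set $A$ of applicants, a finite set $B$ of jobs, and for every applicant $a\in A$ a set of neighbours in $B$ together with a strict linear order on it (her preference list); jobs have no preferences and do not vote. A matching is a set of pairwise disjoint edges $\{a,b\}$ with $b$ a neighbour of $a$. An applicant prefers a matching $M$ to a matching $M'$ if she prefers her partner in $M$ to her partner in $M'$, or if she is matched in $M$ and unmatched in $M'$. A matching $M$ is popular in $I$ if for every matching $M'$ the number of applicants who prefer $M$ to $M'$ is at least the number of applicants who prefer $M'$ to $M$. **Theorem.** There is a polynomial-time algorithm which, given two instances $I$ and $I'$ of the one-sided model with the same applicants, the same jobs and the same graph, in which all applicants except possibly one have the same preference list in $I$ as in $I'$, decides whether there is a matching that is popular both in $I$ and in $I'$ (a robust popular matching), and outputs such a matching if there is one. Here "polynomial-time" means that the number of steps on a unit-cost random access machine (with addition and truncated subtraction as its only arithmetic operations) is bounded by a polynomial in $n+m$, where $n=|A|+|B|$ and $m$ is the total length of all preference lists. -/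

import Mathlib

/-! ### Matchings in the one-sided model -/

/-- An instance of the one-sided model with applicants `A` and jobs `B`. Every applicant has a
strict preference list: her neighbours in the bipartite graph, each listed once, most preferred
first. Jobs have no preferences. -/
structure OneSidedInstance (A B : Type) where
  pref : A → List B
  pref_nodup : ∀ a, (pref a).Nodup

namespace OneSidedInstance

variable {A B : Type}

/-- The edges of the bipartite graph of the instance. -/
def Adj (I : OneSidedInstance A B) (a : A) (b : B) : Prop := b ∈ I.pref a

/-- A matching, given by the partner `M a` of every applicant (`none` if `a` is unmatched):
matched pairs are edges, and no job is matched to two applicants. -/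
def IsMatching (I : OneSidedInstance A B) (M : A → Option B) : Prop :=
  (∀ a b, M a = some b → I.Adj a b) ∧
    ∀ a a' b, M a = some b → M a' = some b → a = a'

/-- Applicant `a` strictly prefers the outcome `x` to the outcome `y`: either both are neighbours
of `a` and `x` comes earlier in her list, or `x` is a neighbour and in `y` she is unmatched. -/
def Prefers [DecidableEq B] (I : OneSidedInstance A B) (a : A) : Option B → Option B → Prop
  | some b, some b' => I.Adj a b ∧ I.Adj a b' ∧ (I.pref a).idxOf b < (I.pref a).idxOf b'
  | some b, none => I.Adj a b
  | none, _ => False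

open Classical in
/-- The vote of an agent between two matchings; jobs abstain. -/
noncomputable def vote [DecidableEq B] (I : OneSidedInstance A B) (M M' : A → Option B) :
    A ⊕ B → ℤ
  | .inl a => if I.Prefers a (M a) (M' a) then 1 else if I.Prefers a (M' a) (M a) then -1 else 0
  | .inr _ => 0

/-- The popularity margin: the sum of the votes of all agents. -/
noncomputable def margin [Fintype A] [Fintype B] [DecidableEq B] (I : OneSidedInstance A B)
    (M M' : A → Option B) : ℤ :=
  ∑ v : A ⊕ B, I.vote M M' v

/-- A matching is popular if it does not lose the election against any matching. -/
def IsPopular [Fintype A] [Fintype B] [DecidableEq B] (I : OneSidedInstance A B)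
    (M : A → Option B) : Prop :=
  I.IsMatching M ∧ ∀ M', I.IsMatching M' → 0 ≤ I.margin M M'

/-- A matching is robust popular for `I` and `I'` if it is popular in both. -/
def IsRobustPopular [Fintype A] [Fintype B] [DecidableEq B] (I I' : OneSidedInstance A B)
    (M : A → Option B) : Prop :=
  I.IsPopular M ∧ I'.IsPopular M

/-- `I'` is a perturbed instance of `I`: the graph is the same, and the preference lists agree
except possibly for the list of one applicant. -/
def IsPerturbation (I I' : OneSidedInstance A B) : Prop :=
  (∀ a b, I.Adj a b ↔ I'.Adj a b) ∧ ∃ a₁, ∀ a, a ≠ a₁ → I'.pref a = I.pref a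

/-- The total length of all preference lists. -/
def totalLength [Fintype A] (I : OneSidedInstance A B) : ℕ := ∑ a, (I.pref a).length

/-- The preference lists written one after the other, each preceded by its length. -/
def encodePrefs {nA nB : ℕ} (I : OneSidedInstance (Fin nA) (Fin nB)) : List ℕ :=
  (List.finRange nA).flatMap fun a => (I.pref a).length :: (I.pref a).map Fin.val

/-- The input of the computational problem: the numbers of applicants and of jobs, then the
preference lists of the two instances. -/
def encodePair {nA nB : ℕ} (I I' : OneSidedInstance (Fin nA) (Fin nB)) : List ℕ :=
  nA :: nB :: (I.encodePrefs ++ I'.encodePrefs)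

end OneSidedInstance

/-- The number that stands for the partner of an applicant in an output: `0` if she is unmatched,
`j + 1` if she is matched to job `j`. -/
def encodePartner {nB : ℕ} : Option (Fin nB) → ℕ
  | none => 0
  | some b => b.val + 1

/-! ### Random access machines with unit cost

The only arithmetic is addition and truncated subtraction (no multiplication), so that the number
of steps is polynomially related to the running time of a Turing machine. -/

namespace RAM

/-- The memory: registers, and arrays that are accessed by indirect addressing. A program names
only finitely many registers and arrays. -/
@[ext] structure Store where
  reg : ℕ → ℕ
  arr : ℕ → ℕ → ℕ

def Store.setReg (s : Store) (x v : ℕ) : Store :=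
  { s with reg := Function.update s.reg x v }

def Store.setArr (s : Store) (k i v : ℕ) : Store :=
  { s with arr := Function.update s.arr k (Function.update (s.arr k) i v) }

/-- Programs; `x`, `y`, `z` are registers, `k` is an array, `c` is a constant. -/
inductive Prog
  /-- do nothing -/
  | skip
  /-- `x := c` -/
  | const (x c : ℕ)
  /-- `x := y` -/
  | copy (x y : ℕ)
  /-- `x := y + z` -/
  | add (x y z : ℕ)
  /-- `x := max (y - z) 0` -/
  | sub (x y z : ℕ)
  /-- `x := k[y]` -/
  | load (x k y : ℕ)
  /-- `k[x] := y` -/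
  | store (k x y : ℕ)
  /-- run `P`, then `Q` -/
  | seq (P Q : Prog)
  /-- if `x ≠ 0` then run `P`, else run `Q` -/
  | ite (x : ℕ) (P Q : Prog)
  /-- while `x ≠ 0`, run `P` -/
  | loop (x : ℕ) (P : Prog)

/-- `Exec P s s' t`: started in memory `s`, the program `P` halts in memory `s'` after exactly `t`
steps, where every elementary instruction and every test of a register is one step. -/
inductive Exec : Prog → Store → Store → ℕ → Prop
  | skip (s) : Exec .skip s s 1
  | const (x c s) : Exec (.const x c) s (s.setReg x c) 1
  | copy (x y s) : Exec (.copy x y) s (s.setReg x (s.reg y)) 1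
  | add (x y z s) : Exec (.add x y z) s (s.setReg x (s.reg y + s.reg z)) 1
  | sub (x y z s) : Exec (.sub x y z) s (s.setReg x (s.reg y - s.reg z)) 1
  | load (x k y s) : Exec (.load x k y) s (s.setReg x (s.arr k (s.reg y))) 1
  | store (k x y s) : Exec (.store k x y) s (s.setArr k (s.reg x) (s.reg y)) 1
  | seq {P Q s₁ s₂ s₃ t₁ t₂} : Exec P s₁ s₂ t₁ → Exec Q s₂ s₃ t₂ → Exec (.seq P Q) s₁ s₃ (t₁ + t₂)
  | ite_true {x P Q s s' t} : s.reg x ≠ 0 → Exec P s s' t → Exec (.ite x P Q) s s' (t + 1)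
  | ite_false {x P Q s s' t} : s.reg x = 0 → Exec Q s s' t → Exec (.ite x P Q) s s' (t + 1)
  | loop_done {x P s} : s.reg x = 0 → Exec (.loop x P) s s 1
  | loop_step {x P s₁ s₂ s₃ t₁ t₂} : s₁.reg x ≠ 0 → Exec P s₁ s₂ t₁ →
      Exec (.loop x P) s₂ s₃ t₂ → Exec (.loop x P) s₁ s₃ (t₁ + t₂ + 1)

/-- The machine is deterministic: final memory and number of steps are determined by the program
and the initial memory. -/
theorem Exec.deterministic {P : Prog} {s s₁ s₂ : Store} {t₁ t₂ : ℕ}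
    (h₁ : Exec P s s₁ t₁) (h₂ : Exec P s s₂ t₂) : s₁ = s₂ ∧ t₁ = t₂ := by
  induction h₁ generalizing s₂ t₂ with
  | seq _ _ ih₁ ih₂ =>
    cases h₂ with
    | seq a b =>
      obtain ⟨rfl, rfl⟩ := ih₁ a
      obtain ⟨rfl, rfl⟩ := ih₂ b
      exact ⟨rfl, rfl⟩
  | ite_true h _ ih =>
    cases h₂ with
    | ite_true _ a => obtain ⟨rfl, rfl⟩ := ih a; exact ⟨rfl, rfl⟩
    | ite_false h' _ => exact absurd h' h
  | ite_false h _ ih =>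
    cases h₂ with
    | ite_true h' _ => exact absurd h h'
    | ite_false _ a => obtain ⟨rfl, rfl⟩ := ih a; exact ⟨rfl, rfl⟩
  | loop_done h =>
    cases h₂ with
    | loop_done _ => exact ⟨rfl, rfl⟩
    | loop_step h' _ _ => exact absurd h h'
  | loop_step h _ _ ih₁ ih₂ =>
    cases h₂ with
    | loop_done h' => exact absurd h' h
    | loop_step _ a b =>
      obtain ⟨rfl, rfl⟩ := ih₁ a
      obtain ⟨rfl, rfl⟩ := ih₂ b
      exact ⟨rfl, rfl⟩
  | _ => cases h₂; exact ⟨rfl, rfl⟩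

/-- The initial memory: array `0` holds the input, register `0` its length, all else is `0`. -/
def init (input : List ℕ) : Store where
  reg x := if x = 0 then input.length else 0
  arr k i := if k = 0 then input.getD i 0 else 0

end RAM

/-! Popularity in the one-sided model is a local condition (`isPopular_iff`): every applicant gets
her first choice or her second choice, the best outcome that is nobody's first choice, and every job
that is somebody's first choice is matched. Being popular in two instances at once therefore just
intersects, applicant by applicant, two sets of at most two outcomes each, and unites the two sets
of jobs that must be matched.

The joint condition becomes a perfect matching problem on `nA + nB` rows and columns. Columns are
the jobs and one last resort per applicant; rows are the applicants and `nB` dummies that absorb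
exactly the columns that may stay unmatched. `IsRobustPopular.hasPerfectMatching` and
`isRobustPopular_of_perfect` give the two directions.

The perfect matching is found by an auction with unit bids, which needs no search for augmenting
paths. A row without a column takes a cheapest adjacent one, raises its price by one and evicts the
owner, who bids next. With `N` columns of price at most `N`, there are at most `N * N` bids. If a
bidder finds no adjacent column below `N`, an empty price level exposes a violation of Hall's
condition (`Auction.not_hasPerfectMatching`).

The machine part is a calculus of total correctness with step counts: `wp`, the rules `wp_loop` and
`wp_forUp`, and a syntactic frame property that recovers everything a subprogram cannot write. -/

namespace RAM

/-! ### Program logic with step counts -/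

/-- The registers that a program may write. -/
def Prog.setsReg : Prog → ℕ → Bool
  | .skip, _ => false
  | .const x _, r => x == r
  | .copy x _, r => x == r
  | .add x _ _, r => x == r
  | .sub x _ _, r => x == r
  | .load x _ _, r => x == r
  | .store _ _ _, _ => false
  | .seq P Q, r => P.setsReg r || Q.setsReg r
  | .ite _ P Q, r => P.setsReg r || Q.setsReg r
  | .loop _ P, r => P.setsReg r

/-- The arrays that a program may write. -/
def Prog.setsArr : Prog → ℕ → Bool
  | .store k _ _, l => k == l
  | .seq P Q, l => P.setsArr l || Q.setsArr l
  | .ite _ P Q, l => P.setsArr l || Q.setsArr l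
  | .loop _ P, l => P.setsArr l
  | _, _ => false

/-- The memories `s` and `s'` agree outside of what `P` may write. -/
structure Frame (P : Prog) (s s' : Store) : Prop where
  reg : ∀ x, P.setsReg x = false → s'.reg x = s.reg x
  arr : ∀ k, P.setsArr k = false → s'.arr k = s.arr k

@[simp] theorem Store.setReg_reg (s : Store) (x v y : ℕ) :
    (s.setReg x v).reg y = if y = x then v else s.reg y := by
  simp [Store.setReg, Function.update_apply]

@[simp] theorem Store.setReg_arr (s : Store) (x v : ℕ) : (s.setReg x v).arr = s.arr := rfl

@[simp] theorem Store.setArr_reg (s : Store) (k i v : ℕ) : (s.setArr k i v).reg = s.reg := rfl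

@[simp] theorem Store.setArr_arr (s : Store) (k i v l : ℕ) :
    (s.setArr k i v).arr l = if l = k then Function.update (s.arr k) i v else s.arr l := by
  simp [Store.setArr, Function.update_apply]

theorem Exec.frame {P : Prog} {s s' : Store} {t : ℕ} (h : Exec P s s' t) : Frame P s s' := by
  induction h with
  | seq _ _ ih₁ ih₂ =>
    constructor <;> intro x hx <;> simp only [Prog.setsReg, Prog.setsArr, Bool.or_eq_false_iff] at hx
    · rw [ih₂.reg x hx.2, ih₁.reg x hx.1]
    · rw [ih₂.arr x hx.2, ih₁.arr x hx.1]
  | ite_true _ _ ih =>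
    constructor <;> intro x hx <;> simp only [Prog.setsReg, Prog.setsArr, Bool.or_eq_false_iff] at hx
    · exact ih.reg x hx.1
    · exact ih.arr x hx.1
  | ite_false _ _ ih =>
    constructor <;> intro x hx <;> simp only [Prog.setsReg, Prog.setsArr, Bool.or_eq_false_iff] at hx
    · exact ih.reg x hx.2
    · exact ih.arr x hx.2
  | loop_step _ _ _ ih₁ ih₂ =>
    constructor <;> intro x hx
    · rw [ih₂.reg x hx, ih₁.reg x hx]
    · rw [ih₂.arr x hx, ih₁.arr x hx]
  | _ =>
    constructor <;> intro x hx <;>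
      simp only [Prog.setsReg, Prog.setsArr, beq_eq_false_iff_ne] at hx <;>
      first | rfl | simp [Ne.symm hx]

/-- Started in `s`, the program `P` halts, and the final memory and the number of steps
satisfy `Q`. -/
def wp (P : Prog) (s : Store) (Q : Store → ℕ → Prop) : Prop :=
  ∃ s' t, Exec P s s' t ∧ Q s' t

/-- The rule of consequence also supplies the frame, so specifications list only what a program
computes; an unchanged register or array is recovered by evaluating `setsReg` or `setsArr`. -/
theorem wp.mono {P : Prog} {s : Store} {Q Q' : Store → ℕ → Prop} (h : wp P s Q)
    (hQ : ∀ s' t, Frame P s s' → Q s' t → Q' s' t) : wp P s Q' := by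
  obtain ⟨s', t, he, hq⟩ := h
  exact ⟨s', t, he, hQ s' t he.frame hq⟩

theorem wp_skip {s Q} : wp .skip s Q ↔ Q s 1 :=
  ⟨fun ⟨_, _, h, hq⟩ => by cases h; exact hq, fun h => ⟨_, _, .skip s, h⟩⟩

theorem wp_const {x c s Q} : wp (.const x c) s Q ↔ Q (s.setReg x c) 1 :=
  ⟨fun ⟨_, _, h, hq⟩ => by cases h; exact hq, fun h => ⟨_, _, .const x c s, h⟩⟩

theorem wp_copy {x y s Q} : wp (.copy x y) s Q ↔ Q (s.setReg x (s.reg y)) 1 :=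
  ⟨fun ⟨_, _, h, hq⟩ => by cases h; exact hq, fun h => ⟨_, _, .copy x y s, h⟩⟩

theorem wp_add {x y z s Q} : wp (.add x y z) s Q ↔ Q (s.setReg x (s.reg y + s.reg z)) 1 :=
  ⟨fun ⟨_, _, h, hq⟩ => by cases h; exact hq, fun h => ⟨_, _, .add x y z s, h⟩⟩

theorem wp_sub {x y z s Q} : wp (.sub x y z) s Q ↔ Q (s.setReg x (s.reg y - s.reg z)) 1 :=
  ⟨fun ⟨_, _, h, hq⟩ => by cases h; exact hq, fun h => ⟨_, _, .sub x y z s, h⟩⟩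

theorem wp_load {x k y s Q} : wp (.load x k y) s Q ↔ Q (s.setReg x (s.arr k (s.reg y))) 1 :=
  ⟨fun ⟨_, _, h, hq⟩ => by cases h; exact hq, fun h => ⟨_, _, .load x k y s, h⟩⟩

theorem wp_store {k x y s Q} :
    wp (.store k x y) s Q ↔ Q (s.setArr k (s.reg x) (s.reg y)) 1 :=
  ⟨fun ⟨_, _, h, hq⟩ => by cases h; exact hq, fun h => ⟨_, _, .store k x y s, h⟩⟩

theorem wp_seq {P R s Q} :
    wp (.seq P R) s Q ↔ wp P s fun s₁ t₁ => wp R s₁ fun s₂ t₂ => Q s₂ (t₁ + t₂) := by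
  constructor
  · rintro ⟨_, _, h, hq⟩
    cases h with
    | seq h₁ h₂ => exact ⟨_, _, h₁, _, _, h₂, hq⟩
  · rintro ⟨_, _, h₁, _, _, h₂, hq⟩
    exact ⟨_, _, .seq h₁ h₂, hq⟩

theorem wp_ite {x P R s Q} :
    wp (.ite x P R) s Q ↔ if s.reg x = 0 then wp R s fun s' t => Q s' (t + 1)
      else wp P s fun s' t => Q s' (t + 1) := by
  split_ifs with hx
  · constructor
    · rintro ⟨_, _, h, hq⟩
      cases h with
      | ite_true h' _ => exact absurd hx h'
      | ite_false _ h => exact ⟨_, _, h, hq⟩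
    · rintro ⟨_, _, h, hq⟩
      exact ⟨_, _, .ite_false hx h, hq⟩
  · constructor
    · rintro ⟨_, _, h, hq⟩
      cases h with
      | ite_true _ h => exact ⟨_, _, h, hq⟩
      | ite_false h' _ => exact absurd h' hx
    · rintro ⟨_, _, h, hq⟩
      exact ⟨_, _, .ite_true hx h, hq⟩

/-- A loop with an invariant, a decreasing measure, and a bounded cost of an iteration. -/
theorem wp_loop {x : ℕ} {P : Prog} {s : Store} (Inv : Store → Prop) (μ : Store → ℕ) (c : ℕ)
    (h₀ : Inv s)
    (step : ∀ s₁, Inv s₁ → Frame (.loop x P) s s₁ → s₁.reg x ≠ 0 →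
      wp P s₁ fun s₂ t => Inv s₂ ∧ μ s₂ < μ s₁ ∧ t ≤ c) :
    wp (.loop x P) s fun s' t => Inv s' ∧ s'.reg x = 0 ∧ t ≤ μ s * (c + 1) + 1 := by
  -- The induction runs over all memories met at the head of the loop, with the frame always taken
  -- relative to the first one, `s`.
  suffices H : ∀ m s₁, μ s₁ = m → Inv s₁ → Frame (.loop x P) s s₁ →
      wp (.loop x P) s₁ fun s' t => Inv s' ∧ s'.reg x = 0 ∧ t ≤ m * (c + 1) + 1 from
    H _ s rfl h₀ ⟨fun _ _ => rfl, fun _ _ => rfl⟩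
  intro m
  induction m using Nat.strong_induction_on with
  | _ m ih =>
    intro s₁ hm hI hF
    by_cases hx : s₁.reg x = 0
    · exact ⟨s₁, 1, .loop_done hx, hI, hx, by omega⟩
    · obtain ⟨s₂, t, he, hI', hμ, ht⟩ := step s₁ hI hF hx
      have hf := he.frame
      obtain ⟨s₃, t', he', hI'', hx', ht'⟩ := ih (μ s₂) (hm ▸ hμ) s₂ rfl hI'
        ⟨fun y hy => (hf.reg y hy).trans (hF.reg y hy),
          fun y hy => (hf.arr y hy).trans (hF.arr y hy)⟩
      refine ⟨s₃, _, .loop_step hx he he', hI'', hx', ?_⟩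
      -- One iteration costs at most `c` plus one test and is paid for by the drop of the measure.
      have : (μ s₂ + 1) * (c + 1) ≤ m * (c + 1) := Nat.mul_le_mul_right _ (by omega)
      rw [Nat.add_mul] at this
      omega

/-- For `i` from `0` to the content of `n` (exclusive), run `P`; the register `g` is auxiliary. -/
def Prog.forUp (i n g : ℕ) (P : Prog) : Prog :=
  .seq (.const i 0) <| .seq (.sub g n i) <|
    .loop g (.seq P <| .seq (.const g 1) <| .seq (.add i i g) (.sub g n i))

/-- Counter and guard change after the body, so `hst` requires an invariant that is insensitive to
both. Besides the body, an iteration has three instructions and a test, hence `c + 4`; the final `3`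
is two initialisations and the last test. -/
theorem wp_forUp {i n g : ℕ} {P : Prog} {s : Store} (Inv : ℕ → Store → Prop) (c : ℕ)
    (hin : i ≠ n) (hig : i ≠ g) (hng : n ≠ g) (hi : P.setsReg i = false) (hn : P.setsReg n = false)
    (hst : ∀ k s v w, Inv k s → Inv k ((s.setReg i v).setReg g w)) (h₀ : Inv 0 s)
    (step : ∀ k s₁, k < s.reg n → s₁.reg i = k → Frame (.forUp i n g P) s s₁ → Inv k s₁ →
      wp P s₁ fun s₂ t => Inv (k + 1) s₂ ∧ t ≤ c) :
    wp (.forUp i n g P) s fun s' t => Inv (s.reg n) s' ∧ t ≤ s.reg n * (c + 4) + 3 := by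
  have hF : Frame (.forUp i n g P) s ((s.setReg i 0).setReg g (s.reg n)) := by
    constructor
    · intro y hy
      simp only [Prog.forUp, Prog.setsReg, Bool.or_eq_false_iff, beq_eq_false_iff_ne] at hy
      simp [hy.1.symm, hy.2.1.symm]
    · intro y hy; rfl
  simp only [Prog.forUp, wp_seq, wp_const, wp_sub]
  have := wp_loop (x := g) (P := .seq P <| .seq (.const g 1) <| .seq (.add i i g) (.sub g n i))
    (s := (s.setReg i 0).setReg g (s.reg n))
    (fun s₁ => s₁.reg g = s.reg n - s₁.reg i ∧ s₁.reg i ≤ s.reg n ∧ Inv (s₁.reg i) s₁)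
    (fun s₁ => s₁.reg g) (c + 3) (by simpa [hig] using hst 0 s 0 (s.reg n) h₀) (by
      rintro s₁ ⟨hg, hle, hI⟩ hf hne
      have hF₁ : Frame (.forUp i n g P) s s₁ :=
        ⟨fun y hy => (hf.reg y (by
            simp only [Prog.forUp, Prog.setsReg, Bool.or_eq_false_iff] at hy ⊢; tauto)).trans
            (hF.reg y hy),
          fun y hy => (hf.arr y (by
            simp only [Prog.forUp, Prog.setsArr, Bool.or_eq_false_iff] at hy ⊢; tauto)).trans
            (hF.arr y hy)⟩
      rw [wp_seq]
      refine (step _ s₁ (by omega) rfl hF₁ hI).mono ?_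
      rintro s₂ t hf₂ ⟨hI₂, ht⟩
      have hn₁ : s₁.reg n = s.reg n := by
        have := hf.reg n (by simp [Prog.setsReg, hn, hin, hng.symm])
        simpa [hng, hin.symm] using this
      have e₁ := hf₂.reg i hi
      have e₂ := (hf₂.reg n hn).trans hn₁
      simp only [wp_seq, wp_const, wp_add, wp_sub]
      refine ⟨⟨?_, ?_, ?_⟩, ?_, ?_⟩
      · simp [hig, hin.symm, hng, e₁, e₂]
      · simp [hig, e₁]; omega
      -- `hst` covers a write to `i` followed by one to `g`; the actual writes `g`, `i`, `g` have
      -- the same effect as two such pairs.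
      · have := hst _ _ (s₁.reg i + 1) (s.reg n - (s₁.reg i + 1))
          (hst _ _ 0 0 hI₂)
        have e : ((((s₂.setReg g 1).setReg i (s₁.reg i + 1)).setReg g
            (s.reg n - (s₁.reg i + 1)))) =
            ((((s₂.setReg i 0).setReg g 0).setReg i (s₁.reg i + 1)).setReg g
              (s.reg n - (s₁.reg i + 1))) := by
          ext y
          · simp only [Store.setReg_reg]; split_ifs <;> rfl
          · rfl
        simpa [hig, hin.symm, hng, e₁, e₂, e] using this
      · simp [hig, hin.symm, hng, e₁, e₂, hg]; omega
      · omega)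
  have e : (s.setReg i 0).reg n - (s.setReg i 0).reg i = s.reg n := by
    simp [hin.symm]
  rw [e]
  refine this.mono ?_
  rintro s' t - ⟨⟨h₁, h₂, h₃⟩, h₄, h₅⟩
  have : s'.reg i = s.reg n := by omega
  refine ⟨this ▸ h₃, ?_⟩
  simp only [Store.setReg_reg, if_true] at h₅
  rw [show c + 3 + 1 = c + 4 from rfl] at h₅
  omega

end RAM

/-! ### The combinatorial characterisation of popular matchings -/

namespace OneSidedInstance

variable {A B : Type}

/-- The job is the first choice of some applicant. -/
def IsTop (I : OneSidedInstance A B) (b : B) : Prop := ∃ a, (I.pref a).head? = some b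

open Classical in
/-- The best outcome of an applicant that is not the first choice of anybody. -/
noncomputable def second (I : OneSidedInstance A B) (a : A) : Option B :=
  (I.pref a).find? fun b => ¬ I.IsTop b

theorem second_eq_some {I : OneSidedInstance A B} {a : A} {b : B} (h : I.second a = some b) :
    I.Adj a b ∧ ¬ I.IsTop b := by
  classical
  exact ⟨List.mem_of_find?_eq_some h, by simpa using List.find?_some h⟩

theorem isMatching_update {I : OneSidedInstance A B} {M : A → Option B} [DecidableEq A]
    (hM : I.IsMatching M) {a : A} {b : B} (hab : I.Adj a b) (hb : ∀ a', a' ≠ a → M a' ≠ some b) :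
    I.IsMatching (Function.update M a (some b)) := by
  constructor
  · intro x c hx
    by_cases h : x = a
    · subst h; simp at hx; exact hx ▸ hab
    · rw [Function.update_of_ne h] at hx; exact hM.1 x c hx
  · intro x y c hx hy
    by_cases h : x = a <;> by_cases h' : y = a
    · rw [h, h']
    · subst h
      rw [Function.update_self] at hx
      rw [Function.update_of_ne h', ← hx] at hy
      exact absurd hy (hb y h')
    · subst h'
      rw [Function.update_self] at hy
      rw [Function.update_of_ne h, ← hy] at hx
      exact absurd hx (hb x h)
    · rw [Function.update_of_ne h] at hx
      rw [Function.update_of_ne h'] at hy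
      exact hM.2 x y c hx hy

variable [DecidableEq B]

/-- The condition of Abraham, Irving, Kavitha and Mehlhorn for popularity. -/
structure IsWellFormed (I : OneSidedInstance A B) (M : A → Option B) : Prop where
  matching : I.IsMatching M
  choice : ∀ a, M a = (I.pref a).head? ∨ M a = I.second a
  top : ∀ b, I.IsTop b → ∃ a, M a = some b

theorem Prefers.asymm {I : OneSidedInstance A B} {a : A} {x y : Option B} (h : I.Prefers a x y) :
    ¬ I.Prefers a y x := by
  rcases x with _ | x <;> rcases y with _ | y <;> simp only [Prefers] at *
  · exact not_false
  · rintro ⟨_, _, h'⟩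
    omega

theorem not_prefers_self (I : OneSidedInstance A B) (a : A) (x : Option B) :
    ¬ I.Prefers a x x := fun h => h.asymm h

theorem vote_inl_le_one (I : OneSidedInstance A B) (M M' : A → Option B) (a : A) :
    I.vote M M' (.inl a) ≤ 1 := by
  unfold vote; dsimp only; split_ifs <;> simp

theorem vote_inl_of_eq {I : OneSidedInstance A B} {M M' : A → Option B} {a : A}
    (h : M a = M' a) : I.vote M M' (.inl a) = 0 := by
  simp [vote, h, not_prefers_self]

theorem vote_inl_of_prefers {I : OneSidedInstance A B} {M M' : A → Option B} {a : A}
    (h : I.Prefers a (M' a) (M a)) : I.vote M M' (.inl a) = -1 := by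
  simp [vote, h, h.asymm]

theorem margin_eq_sum [Fintype A] [Fintype B] (I : OneSidedInstance A B) (M M' : A → Option B) :
    I.margin M M' = ∑ a, I.vote M M' (.inl a) := by
  simp [margin, Fintype.sum_sum_type, vote]

/-- The first choice is preferred to every other outcome. -/
theorem prefers_head {I : OneSidedInstance A B} {a : A} {b : B} {x : Option B}
    (hb : (I.pref a).head? = some b) (hx : ∀ c, x = some c → I.Adj a c) (hne : x ≠ some b) :
    I.Prefers a (some b) x := by
  obtain ⟨l, hl⟩ := List.head?_eq_some_iff.1 hb
  rcases x with _ | c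
  · simp [Prefers, Adj, hl]
  · refine ⟨by simp [Adj, hl], hx c rfl, ?_⟩
    have : b ≠ c := fun h => hne (by rw [h])
    simp [hl, this]

/-- In a popular matching, a job that an applicant would prefer is matched to somebody whose
first choice it is. -/
theorem IsPopular.exists_of_prefers [Fintype A] [Fintype B] {I : OneSidedInstance A B}
    {M : A → Option B} (hM : I.IsPopular M) {a : A} {b : B} (h : I.Prefers a (some b) (M a)) :
    ∃ a', M a' = some b ∧ (I.pref a').head? = some b := by
  classical
  by_contra! hcon
  have hab : I.Adj a b := by
    cases hMa : M a <;> rw [hMa] at h <;> simp only [Prefers] at h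
    · exact h
    · exact h.1
  have hMab : M a ≠ some b := fun h' => I.not_prefers_self a _ (h'.symm ▸ h)
  by_cases hocc : ∃ a', M a' = some b
  · obtain ⟨a', ha'⟩ := hocc
    have hne : a' ≠ a := by rintro rfl; exact hMab ha'
    have hab' := hM.1.1 _ _ ha'
    obtain ⟨c, hc⟩ : ∃ c, (I.pref a').head? = some c := by
      cases hp : I.pref a' with
      | nil => simp [Adj, hp] at hab'
      | cons c l => exact ⟨c, rfl⟩
    have hcb : c ≠ b := by rintro rfl; exact hcon a' ha' hc
    have hac : I.Adj a' c := List.mem_of_mem_head? hc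
    -- The holder `a'` of `b` is promoted to her first choice `c`, which is vacated beforehand, and
    -- `b` passes to `a`.
    set M₀ : A → Option B := fun x => if M x = some c then none else M x with hM₀
    have hM₀m : I.IsMatching M₀ := by
      constructor
      · intro x d hx
        simp only [hM₀] at hx
        split_ifs at hx
        exact hM.1.1 x d hx
      · intro x y d hx hy
        simp only [hM₀] at hx hy
        split_ifs at hx hy
        exact hM.1.2 x y d hx hy
    have hM₀c : ∀ x, M₀ x ≠ some c := by
      intro x hx
      simp only [hM₀] at hx
      split_ifs at hx with h'
      exact h' hx
    have hM₁m := isMatching_update hM₀m hac fun x _ => hM₀c x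
    have hM₂m := isMatching_update hM₁m hab (fun x hx => by
      by_cases hxa : x = a'
      · subst hxa; simpa using hcb
      · rw [Function.update_of_ne hxa]
        intro hx'
        simp only [hM₀] at hx'
        split_ifs at hx'
        exact hxa (hM.1.2 _ _ _ hx' ha'))
    have := hM.2 _ hM₂m
    rw [margin_eq_sum] at this
    set M₂ := Function.update (Function.update M₀ a' (some c)) a (some b) with hM₂
    -- Both `a` and `a'` improve, and only the former holder of `c` can lose, so the margin is at
    -- most `-2 + 1`. The bound remains valid if that holder is `a` herself.
    have key : ∀ x, I.vote M M₂ (.inl x) ≤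
        (if x = a then -1 else 0) + (if x = a' then -1 else 0) +
          (if M x = some c then 1 else 0) := by
      intro x
      by_cases hxa : x = a
      · subst hxa
        rw [vote_inl_of_prefers (by simpa [hM₂] using h)]
        simp only [if_true, if_neg hne.symm]
        split_ifs <;> simp
      · by_cases hxa' : x = a'
        · subst hxa'
          rw [vote_inl_of_prefers]
          · simp [hxa, ha', hcb.symm]
          · rw [hM₂, Function.update_of_ne hxa, Function.update_self]
            exact prefers_head hc (fun d hd => hM.1.1 _ _ hd) (by simp [ha', hcb.symm])
        · simp only [if_neg hxa, if_neg hxa']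
          split_ifs with hx
          · simpa using vote_inl_le_one _ _ _ _
          · rw [vote_inl_of_eq]
            · simp
            · rw [hM₂, Function.update_of_ne hxa, Function.update_of_ne hxa']
              simp [hM₀, hx]
    have hsum := Finset.sum_le_sum fun x (_ : x ∈ Finset.univ) => key x
    rw [Finset.sum_add_distrib, Finset.sum_add_distrib] at hsum
    have hcard : (∑ x, if M x = some c then (1 : ℤ) else 0) ≤ 1 := by
      rw [Finset.sum_boole]
      exact_mod_cast Finset.card_le_one.2 fun x hx y hy =>
        hM.1.2 x y c (by simpa using hx) (by simpa using hy)
    simp only [Finset.sum_ite_eq', Finset.mem_univ, if_true] at hsum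
    omega
  · push Not at hocc
    -- Here `b` is free: giving it to `a` wins one vote and changes nobody else's outcome.
    have hM₁m := isMatching_update hM.1 hab fun x _ => hocc x
    have := hM.2 _ hM₁m
    rw [margin_eq_sum, Finset.sum_eq_single a] at this
    · rw [vote_inl_of_prefers (by simpa using h)] at this
      omega
    · intro x _ hx
      exact vote_inl_of_eq (by rw [Function.update_of_ne hx])
    · simp

/-- An outcome that is preferred to the second choice is the first choice of somebody. -/
theorem isTop_of_prefers_second {I : OneSidedInstance A B} {a : A} {b : B}
    (h : I.Prefers a (some b) (I.second a)) : I.IsTop b := by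
  classical
  by_contra hb
  rcases hs : I.second a with _ | c
  · rw [hs] at h
    have := List.find?_eq_none.1 hs b h
    simp [hb] at this
  · rw [hs] at h
    obtain ⟨hb', -, hlt⟩ := h
    obtain ⟨-, as, bs, hl, hno⟩ := List.find?_eq_some_iff_append.1 hs
    rw [hl] at hlt
    have hbas : b ∉ as := fun hm => by simpa [hb] using hno b hm
    have hcas : c ∉ as := by
      have := I.pref_nodup a
      rw [hl] at this
      exact fun hm => (List.nodup_append.1 this).2.2 _ hm _ (by simp) rfl
    rw [List.idxOf_append_of_notMem hbas, List.idxOf_append_of_notMem hcas] at hlt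
    simp at hlt

/-- Among the outcomes that avoid first choices, `second` is the maximum: anything earlier in the
list would be a first choice by `isTop_of_prefers_second`. -/
theorem prefers_second {I : OneSidedInstance A B} {a : A} {x : Option B}
    (hx : ∀ c, x = some c → I.Adj a c ∧ ¬ I.IsTop c) (hne : x ≠ I.second a) :
    ∃ b, I.second a = some b ∧ I.Prefers a (some b) x := by
  classical
  rcases hs : I.second a with _ | b
  · rcases x with _ | c
    · exact absurd hs.symm hne
    · have := List.find?_eq_none.1 hs c (hx c rfl).1
      simp [(hx c rfl).2] at this
  · refine ⟨b, rfl, ?_⟩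
    have hb := second_eq_some hs
    rcases x with _ | c
    · exact hb.1
    · refine ⟨hb.1, (hx c rfl).1, ?_⟩
      have hbc : c ≠ b := fun h => hne (by rw [h, hs])
      by_contra hle
      have hlt : (I.pref a).idxOf c < (I.pref a).idxOf b := by
        refine lt_of_le_of_ne (not_lt.1 hle) fun h => hbc ?_
        exact (List.idxOf_inj (hx c rfl).1).1 h
      exact (hx c rfl).2 (isTop_of_prefers_second (a := a) (hs ▸ ⟨(hx c rfl).1, hb.1, hlt⟩))

/-- `exists_of_prefers` is used twice. Applied to first choices, it shows that each of them is held
by somebody who ranks it first. An applicant with neither of her two choices thus holds no first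
choice of anybody and prefers her second choice; applied to that job, the lemma would make it
somebody's first choice. -/
theorem IsPopular.isWellFormed [Fintype A] [Fintype B] {I : OneSidedInstance A B}
    {M : A → Option B} (hM : I.IsPopular M) : I.IsWellFormed M := by
  have htop : ∀ b, I.IsTop b → ∃ a, M a = some b ∧ (I.pref a).head? = some b := by
    rintro b ⟨a, ha⟩
    by_cases hMa : M a = some b
    · exact ⟨a, hMa, ha⟩
    · exact hM.exists_of_prefers (prefers_head ha (fun c => hM.1.1 a c) hMa)
  refine ⟨hM.1, fun a => ?_, fun b hb => (htop b hb).imp fun _ h => h.1⟩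
  by_contra! hcon
  obtain ⟨b, hb, hp⟩ := prefers_second (I := I) (a := a) (x := M a) (fun c hc => by
    refine ⟨hM.1.1 a c hc, fun ht => ?_⟩
    obtain ⟨a', ha', hf⟩ := htop c ht
    rw [hM.1.2 _ _ _ hc ha'] at hcon hc
    exact hcon.1 (hc.trans hf.symm)) hcon.2
  obtain ⟨a', -, hf⟩ := hM.exists_of_prefers hp
  exact (second_eq_some hb).2 ⟨a', hf⟩

/-- Whoever improves in `M'` obtains a first-choice job, which in `M` belongs to somebody who ranks
it first and who loses it in `M'`. Charging each winner to that loser is injective, since `M'`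
matches a job only once. -/
theorem IsWellFormed.isPopular [Fintype A] [Fintype B] {I : OneSidedInstance A B}
    {M : A → Option B} (hM : I.IsWellFormed M) : I.IsPopular M := by
  classical
  refine ⟨hM.matching, fun M' hM' => ?_⟩
  have key : ∀ a, I.Prefers a (M' a) (M a) →
      ∃ a', I.Prefers a' (M a') (M' a') ∧ M a' = M' a ∧ M' a ≠ none := by
    intro a ha
    obtain ⟨b, hb⟩ : ∃ b, M' a = some b := by
      cases h : M' a with
      | none => rw [h] at ha; exact ha.elim
      | some b => exact ⟨b, rfl⟩
    have hMa : M a ≠ (I.pref a).head? := fun h => by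
      rcases hp : (I.pref a).head? with _ | c
      · have := hM'.1 a b hb
        rw [List.head?_eq_none_iff] at hp
        simp [Adj, hp] at this
      · by_cases hc : M' a = some c
        · rw [h, hp, hc] at ha
          exact I.not_prefers_self _ _ ha
        · rw [h, hp] at ha
          exact ha.asymm (prefers_head hp (fun d => hM'.1 a d) hc)
    have hs := (hM.choice a).resolve_left hMa
    rw [hs, hb] at ha
    have hbt := isTop_of_prefers_second ha
    obtain ⟨a', ha'⟩ := hM.top b hbt
    refine ⟨a', ?_, by rw [ha', hb], by simp [hb]⟩
    have hf : (I.pref a').head? = some b := by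
      rcases hM.choice a' with h | h
      · rw [← h, ha']
      · exact absurd hbt (second_eq_some (h.symm.trans ha')).2
    rw [ha']
    refine prefers_head hf (fun c => hM'.1 a' c) fun h => ?_
    obtain rfl := hM'.2 _ _ _ h hb
    rw [ha'] at hs
    exact (second_eq_some hs.symm).2 hbt
  choose! φ hφ₁ hφ₂ hφ₃ using key
  have hcard : (Finset.univ.filter fun a => I.Prefers a (M' a) (M a)).card ≤
      (Finset.univ.filter fun a => I.Prefers a (M a) (M' a)).card := by
    refine Finset.card_le_card_of_injOn φ (fun a ha => ?_) fun a ha a' ha' h => ?_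
    · simpa using hφ₁ a (by simpa using ha)
    · have h₁ := hφ₂ a (by simpa using ha)
      have h₂ := hφ₂ a' (by simpa using ha')
      obtain ⟨b, hb⟩ := Option.ne_none_iff_exists'.1 (hφ₃ a (by simpa using ha))
      exact hM'.2 a a' b hb (by rw [← h₂, ← h, h₁, hb])
  have hv : ∀ a, I.vote M M' (.inl a) = (if I.Prefers a (M a) (M' a) then 1 else 0) -
      (if I.Prefers a (M' a) (M a) then 1 else 0) := by
    intro a
    unfold vote
    dsimp only
    split_ifs with h₁ h₂ <;> first | exact absurd h₂ h₁.asymm | simp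
  rw [margin_eq_sum, Finset.sum_congr rfl fun a _ => hv a, Finset.sum_sub_distrib,
    Finset.sum_boole, Finset.sum_boole]
  have : ((Finset.univ.filter fun a => I.Prefers a (M' a) (M a)).card : ℤ) ≤
      (Finset.univ.filter fun a => I.Prefers a (M a) (M' a)).card := by exact_mod_cast hcard
  linarith

/-- A matching is popular iff everybody gets her first or second choice and all first choices
are matched. -/
theorem isPopular_iff [Fintype A] [Fintype B] {I : OneSidedInstance A B} {M : A → Option B} :
    I.IsPopular M ↔ I.IsWellFormed M :=
  ⟨IsPopular.isWellFormed, IsWellFormed.isPopular⟩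

end OneSidedInstance

/-! ### Perfect matchings by an auction -/

/-- A perfect matching of `N` rows with `N` columns along `E`. -/
def HasPerfectMatching (N : ℕ) (E : ℕ → ℕ → Prop) : Prop :=
  ∃ σ : ℕ → ℕ, (∀ i < N, σ i < N ∧ E i (σ i)) ∧ Set.InjOn σ (Finset.range N)

/-- The state of an auction: column `j` belongs to row `i` if `own j = i + 1` and to nobody if
`own j = 0`; its price is `d j`. Every owner holds a column that is cheapest for it up to `1`. -/
structure Auction (N : ℕ) (E : ℕ → ℕ → Prop) (own d : ℕ → ℕ) : Prop where
  adj : ∀ j < N, ∀ i, own j = i + 1 → E i j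
  cheap : ∀ j < N, ∀ i, own j = i + 1 → ∀ j' < N, E i j' → d j ≤ d j' + 1
  inj : ∀ j < N, ∀ j' < N, ∀ i, own j = i + 1 → own j' = i + 1 → j = j'
  zero : ∀ j < N, own j = 0 → d j = 0
  le : ∀ j < N, d j ≤ N

/-- Row `i` owns a column. -/
def Owns (N : ℕ) (own : ℕ → ℕ) (i : ℕ) : Prop := ∃ j < N, own j = i + 1

namespace Auction

variable {N : ℕ} {E : ℕ → ℕ → Prop} {own d : ℕ → ℕ}

theorem start : Auction N E (fun _ => 0) (fun _ => 0) where
  adj := by simp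
  cheap := by simp
  inj := by simp
  zero := by simp
  le := by simp

/-- The row `i` buys a cheapest column `b`. -/
theorem bid (h : Auction N E own d) {i b : ℕ} (hi : ¬ Owns N own i) (hb : b < N) (hE : E i b)
    (hd : d b < N) (hmin : ∀ j < N, E i j → d b ≤ d j) :
    Auction N E (Function.update own b (i + 1)) (Function.update d b (d b + 1)) := by
  have hmono : ∀ j, d j ≤ Function.update d b (d b + 1) j := by
    intro j
    by_cases hj : j = b
    · subst hj; simp
    · rw [Function.update_of_ne hj]
  constructor
  · intro j hj i' hi'
    by_cases hjb : j = b
    · subst hjb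
      obtain rfl : i = i' := by simpa using hi'
      exact hE
    · rw [Function.update_of_ne hjb] at hi'
      exact h.adj j hj i' hi'
  -- The buyer pays one more than the minimum, exactly the permitted slack; for the other owners,
  -- alternatives only become dearer.
  · intro j hj i' hi' j' hj' hE'
    by_cases hjb : j = b
    · subst hjb
      obtain rfl : i = i' := by simpa using hi'
      have := hmin j' hj' hE'
      have := hmono j'
      simp only [Function.update_self]
      omega
    · rw [Function.update_of_ne hjb] at hi' ⊢
      exact (h.cheap j hj i' hi' j' hj' hE').trans (Nat.add_le_add_right (hmono j') 1)
  · intro j hj j' hj' i' hi' hi''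
    by_cases hjb : j = b <;> by_cases hjb' : j' = b
    · rw [hjb, hjb']
    · subst hjb
      obtain rfl : i = i' := by simpa using hi'
      rw [Function.update_of_ne hjb'] at hi''
      exact absurd ⟨j', hj', hi''⟩ hi
    · subst hjb'
      obtain rfl : i = i' := by simpa using hi''
      rw [Function.update_of_ne hjb] at hi'
      exact absurd ⟨j, hj, hi'⟩ hi
    · rw [Function.update_of_ne hjb] at hi'
      rw [Function.update_of_ne hjb'] at hi''
      exact h.inj j hj j' hj' i' hi' hi''
  · intro j hj h0
    by_cases hjb : j = b
    · subst hjb; simp at h0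
    · rw [Function.update_of_ne hjb] at h0 ⊢
      exact h.zero j hj h0
  · intro j hj
    by_cases hjb : j = b
    · subst hjb; simpa using hd
    · rw [Function.update_of_ne hjb]
      exact h.le j hj

/-- The evicted row has no second column, by `inj`, so a bid exchanges at most one owner for the
bidder. -/
theorem owns_bid (h : Auction N E own d) {i b : ℕ} (hb : b < N) (i' : ℕ) :
    Owns N (Function.update own b (i + 1)) i' ↔ i' = i ∨ Owns N own i' ∧ own b ≠ i' + 1 := by
  constructor
  · rintro ⟨j, hj, hji⟩
    by_cases hjb : j = b
    · subst hjb
      left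
      simpa using hji.symm
    · rw [Function.update_of_ne hjb] at hji
      exact Or.inr ⟨⟨j, hj, hji⟩, fun hbi => hjb (h.inj j hj b hb i' hji hbi)⟩
  · rintro (rfl | ⟨⟨j, hj, hji⟩, hne⟩)
    · exact ⟨b, hb, by simp⟩
    · refine ⟨j, hj, ?_⟩
      rw [Function.update_of_ne (by rintro rfl; exact hne hji), hji]

/-- If all columns adjacent to a row without a column have the maximum price, then a price level
is empty, and the columns above it violate the condition of Hall. -/
theorem not_hasPerfectMatching (h : Auction N E own d) (hown : ∀ j < N, own j ≤ N) {i : ℕ}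
    (hiN : i < N) (hi : ¬ Owns N own i) (hmax : ∀ j < N, E i j → N ≤ d j) :
    ¬ HasPerfectMatching N E := by
  rintro ⟨σ, hσ, hinj⟩
  -- Pigeonhole: there are `N + 1` price levels from `0` to `N` but only `N` columns.
  obtain ⟨l, hl, hld⟩ : ∃ l ≤ N, ∀ j < N, d j ≠ l := by
    by_contra! hcon
    have hsub : Finset.range (N + 1) ⊆ (Finset.range N).image d := by
      intro l hl
      obtain ⟨j, hj, hjl⟩ := hcon l (by simpa [Nat.lt_succ_iff] using hl)
      exact Finset.mem_image.2 ⟨j, by simpa using hj, hjl⟩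
    have h₁ := Finset.card_le_card hsub
    have h₂ := Finset.card_image_le (s := Finset.range N) (f := d)
    simp only [Finset.card_range] at h₁ h₂
    omega
  set S := (Finset.range N).filter fun j => l < d j with hS
  set T := insert i (S.image fun j => own j - 1) with hT
  have hpos : ∀ j ∈ S, ∃ i', own j = i' + 1 := by
    intro j hj
    simp only [hS, Finset.mem_filter, Finset.mem_range] at hj
    refine Nat.exists_eq_add_one.2 (Nat.pos_of_ne_zero fun h0 => ?_)
    have := h.zero j hj.1 h0
    omega
  have hcard : T.card = S.card + 1 := by
    rw [hT, Finset.card_insert_of_notMem, Finset.card_image_of_injOn]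
    · intro j hj j' hj' he
      obtain ⟨i₁, h₁⟩ := hpos j hj
      obtain ⟨i₂, h₂⟩ := hpos j' hj'
      simp only [h₁, h₂, Nat.add_sub_cancel] at he
      simp only [hS, Finset.coe_filter, Finset.mem_range, Set.mem_ofPred_eq] at hj hj'
      exact h.inj j hj.1 j' hj'.1 i₁ h₁ (he ▸ h₂)
    · simp only [Finset.mem_image, not_exists, not_and]
      intro j hj he
      obtain ⟨i', h'⟩ := hpos j hj
      simp only [hS, Finset.mem_filter, Finset.mem_range] at hj
      exact hi ⟨j, hj.1, by omega⟩
  -- Neighbours of rows in `T` cost at least `l`: at least `N` for `i`, and for the owner of a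
  -- column dearer than `l` by `cheap`. As level `l` is empty, they cost more than `l`, so the
  -- `S.card + 1` rows of `T` compete for the columns of `S`.
  have hmaps : ∀ x ∈ T, x < N ∧ σ x ∈ S := by
    intro x hx
    rcases Finset.mem_insert.1 hx with rfl | hx
    · have := hmax _ (hσ x hiN).1 (hσ x hiN).2
      have hne := hld _ (hσ x hiN).1
      refine ⟨hiN, Finset.mem_filter.2 ⟨Finset.mem_range.2 (hσ x hiN).1, ?_⟩⟩
      omega
    · obtain ⟨j, hj, rfl⟩ := Finset.mem_image.1 hx
      obtain ⟨x, hx⟩ := hpos j hj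
      simp only [hx, Nat.add_sub_cancel]
      simp only [hS, Finset.mem_filter, Finset.mem_range] at hj
      have hxN : x < N := by have := hown j hj.1; omega
      have := h.cheap j hj.1 x hx _ (hσ x hxN).1 (hσ x hxN).2
      have hne := hld _ (hσ x hxN).1
      refine ⟨hxN, Finset.mem_filter.2 ⟨Finset.mem_range.2 (hσ x hxN).1, ?_⟩⟩
      omega
  have := Finset.card_le_card_of_injOn σ (fun x hx => (hmaps x hx).2)
    (hinj.mono fun x hx => by simpa using (hmaps x hx).1)
  omega

/-- The sum of the prices is the potential that bounds the number of bids, together with `sum_le`.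
-/
theorem sum_update {b : ℕ} (hb : b < N) (d : ℕ → ℕ) :
    ∑ j ∈ Finset.range N, Function.update d b (d b + 1) j = (∑ j ∈ Finset.range N, d j) + 1 := by
  have := Finset.sum_update_of_mem (Finset.mem_range.2 hb) d (d b)
  rw [Function.update_eq_self] at this
  rw [Finset.sum_update_of_mem (Finset.mem_range.2 hb), this]
  omega

theorem sum_le (h : Auction N E own d) : ∑ j ∈ Finset.range N, d j ≤ N * N := by
  simpa using Finset.sum_le_card_nsmul (Finset.range N) d N fun j hj => h.le j (by simpa using hj)

end Auction

/-- Every row owns an adjacent column. -/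
def IsPerfect (N : ℕ) (E : ℕ → ℕ → Prop) (own : ℕ → ℕ) : Prop :=
  ∀ i < N, ∃ j < N, own j = i + 1 ∧ E i j

/-- An injection between sets of equal size is onto, so `own` is a full inverse of `σ`. The last
clause serves `output`, which reads the table column by column. -/
theorem IsPerfect.hasPerfectMatching {N : ℕ} {E : ℕ → ℕ → Prop} {own : ℕ → ℕ}
    (h : IsPerfect N E own) : ∃ σ : ℕ → ℕ, ((∀ i < N, σ i < N ∧ E i (σ i)) ∧
      Set.InjOn σ (Finset.range N)) ∧ ∀ j < N, ∃ i < N, σ i = j ∧ own j = i + 1 := by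
  choose! σ h₁ h₂ h₃ using h
  have hinj : Set.InjOn σ (Finset.range N) := by
    intro i hi i' hi' he
    have e₁ := h₂ i (by simpa using hi)
    have e₂ := h₂ i' (by simpa using hi')
    rw [he, e₂] at e₁
    omega
  refine ⟨σ, ⟨fun i hi => ⟨h₁ i hi, h₃ i hi⟩, hinj⟩, fun j hj => ?_⟩
  have := Finset.surjOn_of_injOn_of_card_le σ (s := Finset.range N) (t := Finset.range N)
    (fun i hi => by simpa using h₁ i (by simpa using hi)) hinj le_rfl
  obtain ⟨i, hi, rfl⟩ := this (by simpa using hj : j ∈ (Finset.range N : Set ℕ))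
  exact ⟨i, by simpa using hi, rfl, h₂ i (by simpa using hi)⟩

/-! ### Robust popular matchings as perfect matchings -/

namespace OneSidedInstance

variable {nA nB : ℕ}

/-- The number of an outcome of applicant `a`: jobs keep their number, and being unmatched is
represented by a last resort job `nB + a` of her own. -/
def outcomeCode (a : Fin nA) : Option (Fin nB) → ℕ
  | none => nB + a
  | some b => b

/-- Row `a < nA` is adjacent to the outcomes of applicant `a` that can occur in a popular matching
of both instances; the remaining rows to all jobs that need not be matched. -/
def RobustAdj (I I' : OneSidedInstance (Fin nA) (Fin nB)) (i j : ℕ) : Prop :=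
  if h : i < nA then
    (j = outcomeCode ⟨i, h⟩ (I.pref ⟨i, h⟩).head? ∨ j = outcomeCode ⟨i, h⟩ (I.second ⟨i, h⟩)) ∧
    (j = outcomeCode ⟨i, h⟩ (I'.pref ⟨i, h⟩).head? ∨ j = outcomeCode ⟨i, h⟩ (I'.second ⟨i, h⟩))
  else ∀ b : Fin nB, j = b → ¬ I.IsTop b ∧ ¬ I'.IsTop b

theorem outcomeCode_injective (a : Fin nA) :
    Function.Injective (outcomeCode a : Option (Fin nB) → ℕ) := by
  intro x y h
  rcases x with _ | x <;> rcases y with _ | y <;> simp only [outcomeCode] at h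
  · rfl
  · have := y.2; omega
  · have := x.2; omega
  · rw [Fin.ext h]

theorem outcomeCode_lt (a : Fin nA) (x : Option (Fin nB)) : outcomeCode a x < nA + nB := by
  have := a.2
  rcases x with _ | x
  · simp only [outcomeCode]; omega
  · have := x.2; simp only [outcomeCode]; omega

/-- A matching that is robust popular yields a perfect matching of rows and outcomes. -/
theorem IsRobustPopular.hasPerfectMatching {I I' : OneSidedInstance (Fin nA) (Fin nB)}
    {M : Fin nA → Option (Fin nB)} (hM : I.IsRobustPopular I' M) :
    HasPerfectMatching (nA + nB) (I.RobustAdj I') := by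
  classical
  have h := isPopular_iff.1 hM.1
  have h' := isPopular_iff.1 hM.2
  set f : ℕ → ℕ := fun i => if hi : i < nA then outcomeCode ⟨i, hi⟩ (M ⟨i, hi⟩) else 0 with hf
  have hfa : ∀ i (hi : i < nA), f i = outcomeCode ⟨i, hi⟩ (M ⟨i, hi⟩) := fun i hi => dif_pos hi
  have himg : (Finset.univ.filter fun i : Fin (nA + nB) => (i : ℕ) < nA).image
      (fun i : Fin (nA + nB) => f i) ⊆ Finset.range (nA + nB) := by
    intro j hj
    obtain ⟨i, hi, rfl⟩ := Finset.mem_image.1 hj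
    rw [hfa i (by simpa using hi)]
    exact Finset.mem_range.2 (outcomeCode_lt _ _)
  have hinj : Set.InjOn (fun i : Fin (nA + nB) => f i)
      (Finset.univ.filter fun i : Fin (nA + nB) => (i : ℕ) < nA) := by
    intro i hi i' hi' he
    have hi : (i : ℕ) < nA := by simpa using hi
    have hi' : (i' : ℕ) < nA := by simpa using hi'
    simp only [hfa _ hi, hfa _ hi'] at he
    rcases hx : M ⟨i, hi⟩ with _ | b <;> rcases hx' : M ⟨i', hi'⟩ with _ | b' <;>
      simp only [hx, hx', outcomeCode] at he
    · exact Fin.ext (by omega)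
    · omega
    · omega
    · have := hM.1.1.2 _ _ _ hx (by rw [hx', Fin.ext he])
      exact Fin.ext (by simpa using this)
  -- The applicants' outcomes form a partial injection; any extension to a bijection will do, since
  -- dummy rows then receive only columns not used by `M`.
  obtain ⟨g, hg⟩ := Finset.exists_equiv_extend_of_card_eq (by simp) himg hinj
  have hlt : ∀ i, (g i : ℕ) < nA + nB := fun i => Finset.mem_range.1 (g i).2
  refine ⟨fun i => if hi : i < nA + nB then g ⟨i, hi⟩ else 0, fun i hi => ?_, ?_⟩
  · simp only [dif_pos hi]
    refine ⟨hlt _, ?_⟩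
    unfold RobustAdj
    by_cases hi' : i < nA
    · rw [dif_pos hi', hg ⟨i, hi⟩ (by simpa using hi'), hfa i hi']
      exact ⟨(h.choice ⟨i, hi'⟩).imp (congrArg _) (congrArg _),
        (h'.choice ⟨i, hi'⟩).imp (congrArg _) (congrArg _)⟩
    · rw [dif_neg hi']
      intro b hb
      -- A job given to a dummy row is unmatched in `M`, hence nobody's first choice in either
      -- instance.
      suffices H : ∀ a, M a ≠ some b from
        ⟨fun ht => (h.top b ht).elim H, fun ht => (h'.top b ht).elim H⟩
      intro a ha
      have hga := hg ⟨a, by have := a.2; omega⟩ (by simp)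
      simp only [hfa _ a.2, ha, outcomeCode] at hga
      have := g.injective (Subtype.ext (hga.trans hb.symm))
      simp only [Fin.mk.injEq] at this
      omega
  · intro i hi i' hi' he
    have hi : i < nA + nB := by simpa using hi
    have hi' : i' < nA + nB := by simpa using hi'
    simp only [dif_pos hi, dif_pos hi'] at he
    simpa using g.injective (Subtype.ext he)

/-- A perfect matching of rows and outcomes yields a matching that is robust popular. -/
theorem isRobustPopular_of_perfect {I I' : OneSidedInstance (Fin nA) (Fin nB)} {σ : ℕ → ℕ}
    (hadj : ∀ a b, I.Adj a b ↔ I'.Adj a b)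
    (hσ : ∀ i < nA + nB, σ i < nA + nB ∧ I.RobustAdj I' i (σ i))
    (hinj : Set.InjOn σ (Finset.range (nA + nB))) {M : Fin nA → Option (Fin nB)}
    (hM : ∀ a : Fin nA, σ a = outcomeCode a (M a)) : I.IsRobustPopular I' M := by
  classical
  have hch : ∀ a : Fin nA, (M a = (I.pref a).head? ∨ M a = I.second a) ∧
      (M a = (I'.pref a).head? ∨ M a = I'.second a) := by
    intro a
    have := (hσ a (by have := a.2; omega)).2
    rw [RobustAdj, dif_pos a.2, hM] at this
    exact this.imp (.imp (fun h => outcomeCode_injective a h) (fun h => outcomeCode_injective a h))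
      (.imp (fun h => outcomeCode_injective a h) (fun h => outcomeCode_injective a h))
  have hmatch : I.IsMatching M := by
    constructor
    · intro a b hab
      rcases (hch a).1 with h | h
      · exact List.mem_of_mem_head? (h.symm.trans hab)
      · exact (second_eq_some (h.symm.trans hab)).1
    · intro a a' b h h'
      have h₁ := hM a
      have h₂ := hM a'
      rw [h] at h₁
      rw [h'] at h₂
      have := hinj (by have := a.2; simp; omega) (by have := a'.2; simp; omega) (h₁.trans h₂.symm)
      exact Fin.ext this
  have hmatch' : I'.IsMatching M := ⟨fun a b h => (hadj a b).1 (hmatch.1 a b h), hmatch.2⟩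
  -- By counting, every column is used. Dummy rows are not adjacent to first choices, so these go to
  -- applicants.
  have hsurj := Finset.surjOn_of_injOn_of_card_le σ (s := Finset.range (nA + nB))
    (t := Finset.range (nA + nB)) (fun i hi => by simpa using (hσ i (by simpa using hi)).1)
    hinj le_rfl
  have htop : ∀ b : Fin nB, I.IsTop b ∨ I'.IsTop b → ∃ a, M a = some b := by
    intro b hb
    obtain ⟨i, hi, hib⟩ := hsurj
      (by have := b.2; simp; omega : (b : ℕ) ∈ (Finset.range (nA + nB) : Set ℕ))
    have hi : i < nA + nB := by simpa using hi
    by_cases hi' : i < nA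
    · exact ⟨⟨i, hi'⟩, outcomeCode_injective ⟨i, hi'⟩ ((hM ⟨i, hi'⟩).symm.trans hib)⟩
    · have := (hσ i hi).2
      rw [RobustAdj, dif_neg hi'] at this
      exact absurd hb (not_or.2 (this b hib))
  exact ⟨isPopular_iff.2 ⟨hmatch, fun a => (hch a).1, fun b hb => htop b (.inl hb)⟩,
    isPopular_iff.2 ⟨hmatch', fun a => (hch a).2, fun b hb => htop b (.inr hb)⟩⟩

end OneSidedInstance

namespace RAM

infixr:60 " ⨟ " => Prog.seq

/-! ### Reading the preference lists

Registers: `1`, `2`, `3` hold the numbers of applicants, of jobs, and their sum, `4` the position in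
the input, `5` and `7` are loop indices, `6` and `8` loop guards, `9` to `13` are temporary. -/

/-- Starting from position `off a`, the memory holds the length of the list `g a`, then the list. -/
structure Rows (mem off : ℕ → ℕ) (g : ℕ → List ℕ) (n : ℕ) : Prop where
  len : ∀ a < n, mem (off a) = (g a).length
  item : ∀ a < n, ∀ i (h : i < (g a).length), mem (off a + 1 + i) = (g a)[i]
  next : ∀ a < n, off (a + 1) = off a + 1 + (g a).length

/-- Mark the first choices in the array `kF`, and write the first choice of every applicant to the
array `kf`. -/
def firstChoices (kF kf : ℕ) : Prog :=
  .forUp 5 1 6 (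
    .load 9 0 4 ⨟ .const 10 1 ⨟ .add 11 4 10 ⨟
    .ite 9 (.load 12 0 11 ⨟ .store kF 12 10 ⨟ .store kf 5 12) (.add 12 2 5 ⨟ .store kf 5 12) ⨟
    .add 4 11 9)

/-- Write to the array `ks` the first item on the list of every applicant that is not marked in the
array `kF`. -/
def secondChoices (kF ks : ℕ) : Prog :=
  .forUp 5 1 6 (
    .load 9 0 4 ⨟ .add 10 4 9 ⨟ .add 13 2 5 ⨟
    .forUp 7 9 8 (.sub 11 10 7 ⨟ .load 11 0 11 ⨟ .load 12 kF 11 ⨟ .ite 12 .skip (.copy 13 11)) ⨟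
    .store ks 5 13 ⨟ .const 11 1 ⨟ .add 4 4 9 ⨟ .add 4 4 11)

/-- Second choices need the complete set of marks, so the lists are read twice; register `14` keeps
their starting position. -/
def choices (kF kf ks : ℕ) : Prog :=
  .copy 14 4 ⨟ firstChoices kF kf ⨟ .copy 4 14 ⨟ secondChoices kF ks

theorem wp_firstChoices {kF kf : ℕ} (h0F : kF ≠ 0) (h0f : kf ≠ 0) (hFf : kF ≠ kf) {s : Store}
    {off : ℕ → ℕ} {g : ℕ → List ℕ} (hr : Rows (s.arr 0) off g (s.reg 1)) (hpos : s.reg 4 = off 0)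
    (hF : ∀ j, s.arr kF j = 0) :
    wp (firstChoices kF kf) s fun s' t =>
      (∀ j, s'.arr kF j = 0 ↔ ∀ a < s.reg 1, (g a).head? ≠ some j) ∧
      (∀ a < s.reg 1, s'.arr kf a = (g a).head?.getD (s.reg 2 + a)) ∧ t ≤ s.reg 1 * 14 + 3 := by
  refine (wp_forUp (fun k s' => s'.reg 4 = off k ∧
      (∀ j, s'.arr kF j = 0 ↔ ∀ a < k, (g a).head? ≠ some j) ∧
      (∀ a < k, s'.arr kf a = (g a).head?.getD (s.reg 2 + a))) 10 (by decide) (by decide)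
      (by decide) rfl rfl ?_ ?_ ?_).mono fun s' t _ h => ⟨h.1.2.1, h.1.2.2, h.2⟩
  · intro k s v w h
    simpa using h
  · simp [hpos, hF]
  · rintro k s₁ hk hi hf ⟨hp, hF₁, hf₁⟩
    have e2 : s₁.reg 2 = s.reg 2 := hf.reg 2 rfl
    have e0 : s₁.arr 0 = s.arr 0 := hf.arr 0 (by simp [Prog.forUp, Prog.setsArr, h0F, h0f])
    have hlen := hr.len k hk
    have hnext := hr.next k hk
    have hF₂ : ∀ j, (∀ a < k + 1, (g a).head? ≠ some j) ↔
        s₁.arr kF j = 0 ∧ (g k).head? ≠ some j := by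
      intro j
      rw [hF₁, Nat.forall_lt_succ_right]
    simp only [hF₂, Nat.forall_lt_succ_right, wp_seq, wp_load, wp_const, wp_add, wp_store, wp_ite,
      Store.setReg_reg, Store.setReg_arr, Store.setArr_reg, Store.setArr_arr, Nat.reduceEqDiff,
      if_true, if_false, hFf, hFf.symm, e0, e2, hp, hi, hlen, hnext,
      List.length_eq_zero_iff]
    split_ifs with hnil
    · simp [hnil]
      intro a ha
      rw [Function.update_of_ne (by omega), hf₁ a ha]
    · obtain ⟨b, l, hbl⟩ := List.exists_cons_of_ne_nil hnil
      have hb := hr.item k hk 0 (by simp [hbl])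
      simp only [hbl, List.getElem_cons_zero, Nat.add_zero] at hb
      simp only [hbl, hb, List.head?_cons, Function.update_self, Option.getD_some]
      refine ⟨⟨by simp, fun j => ?_, fun a ha => ?_, trivial⟩, by omega⟩
      · by_cases hj : j = b
        · simp [hj]
        · rw [Function.update_of_ne hj]
          simp [Ne.symm hj]
      · rw [Function.update_of_ne (by omega), hf₁ a ha]

/-- The inner loop runs from the end of a list to its front and overwrites register `13` at each
unmarked item, so the earliest one survives without an early exit. The initial value is the
applicant's last resort. -/
theorem wp_secondChoices {kF ks : ℕ} (h0s : ks ≠ 0) (hFs : kF ≠ ks) {s : Store}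
    {off : ℕ → ℕ} {g : ℕ → List ℕ} (hr : Rows (s.arr 0) off g (s.reg 1)) (hpos : s.reg 4 = off 0)
    {L : ℕ} (hL : ∀ a < s.reg 1, (g a).length ≤ L) :
    wp (secondChoices kF ks) s fun s' t => s'.reg 4 = off (s.reg 1) ∧
      (∀ a < s.reg 1, s'.arr ks a =
        ((g a).find? fun j => s.arr kF j = 0).getD (s.reg 2 + a)) ∧
      t ≤ s.reg 1 * (L * 9 + 14) + 3 := by
  refine (wp_forUp (fun k s' => s'.reg 4 = off k ∧
      (∀ a < k, s'.arr ks a = ((g a).find? fun j => s.arr kF j = 0).getD (s.reg 2 + a)))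
      (L * 9 + 10) (by decide) (by decide)
      (by decide) rfl rfl ?_ ?_ ?_).mono fun s' t _ h => ⟨h.1.1, h.1.2, h.2⟩
  · intro k s v w h
    simpa using h
  · simp [hpos]
  · rintro k s₁ hk hi hf ⟨hp, hs₁⟩
    have e2 : s₁.reg 2 = s.reg 2 := hf.reg 2 rfl
    have e0 : s₁.arr 0 = s.arr 0 := hf.arr 0 (by simp [Prog.forUp, Prog.setsArr, h0s])
    have eF : s₁.arr kF = s.arr kF := hf.arr kF (by simp [Prog.forUp, Prog.setsArr, hFs.symm])
    have hlen := hr.len k hk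
    have hnext := hr.next k hk
    have hLk := hL k hk
    simp only [Nat.forall_lt_succ_right, wp_seq, wp_load, wp_const, wp_add, wp_store,
      Store.setReg_reg, Store.setReg_arr, Nat.reduceEqDiff,
      if_true, if_false, e0, e2, hp, hi, hlen, hnext]
    refine (wp_forUp (fun i s' => s'.reg 13 = (((g k).drop ((g k).length - i)).find?
      fun j => s.arr kF j = 0).getD (s.reg 2 + k)) 5 (by decide) (by decide) (by decide) rfl rfl
      ?_ ?_ ?_).mono ?_
    · intro k s v w h
      simpa using h
    · simp
    · intro i s₂ hik hi₂ hf₂ h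
      have e9 := hf₂.reg 9 rfl
      have e10 := hf₂.reg 10 rfl
      have e0' := hf₂.arr 0 rfl
      have eF' := hf₂.arr kF rfl
      simp only [Store.setReg_reg, Store.setReg_arr, Nat.reduceEqDiff, if_true, if_false] at *
      have hx := hr.item k hk ((g k).length - (i + 1)) (by omega)
      -- The cell holding the length shifts the items by one, which cancels the one in `i + 1`.
      rw [show off k + 1 + ((g k).length - (i + 1)) = off k + (g k).length - i by omega] at hx
      have hd := List.drop_eq_getElem_cons (l := g k) (i := (g k).length - (i + 1)) (by omega)
      rw [show (g k).length - (i + 1) + 1 = (g k).length - i by omega] at hd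
      simp only [wp_seq, wp_load, wp_sub, wp_ite, wp_skip, wp_copy, Store.setReg_reg,
        Store.setReg_arr, Nat.reduceEqDiff, if_true, if_false, e10, hi₂, e0', eF', e0, eF, hx,
        hd, List.find?_cons]
      split_ifs with h0
      · simp [h0]
      · simp [h0, h]
    · rintro s₂ t hf₂ ⟨h, ht⟩
      have e1 := hf₂.reg 1 rfl
      have e2 := hf₂.reg 2 rfl
      have e4 := hf₂.reg 4 rfl
      have e5 := hf₂.reg 5 rfl
      have e9 := hf₂.reg 9 rfl
      have es := hf₂.arr ks rfl
      simp only [Store.setReg_reg, Store.setReg_arr, Nat.reduceEqDiff, if_true, if_false,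
        Store.setArr_reg, Store.setArr_arr] at *
      simp only [e4, e5, e9, es, hi, hp, h, Function.update_self]
      refine ⟨⟨by omega, fun a ha => ?_, by simp⟩, by omega⟩
      rw [Function.update_of_ne (by omega), hs₁ a ha]

theorem wp_choices {kF kf ks : ℕ} (h0F : kF ≠ 0) (h0f : kf ≠ 0) (h0s : ks ≠ 0) (hFf : kF ≠ kf)
    (hFs : kF ≠ ks) (hfs : kf ≠ ks) {s : Store}
    {off : ℕ → ℕ} {g : ℕ → List ℕ} (hr : Rows (s.arr 0) off g (s.reg 1)) (hpos : s.reg 4 = off 0)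
    (hF : ∀ j, s.arr kF j = 0) {L : ℕ} (hL : ∀ a < s.reg 1, (g a).length ≤ L) :
    wp (choices kF kf ks) s fun s' t => s'.reg 4 = off (s.reg 1) ∧
      (∀ j, s'.arr kF j = 0 ↔ ∀ a < s.reg 1, (g a).head? ≠ some j) ∧
      (∀ a < s.reg 1, s'.arr kf a = (g a).head?.getD (s.reg 2 + a)) ∧
      (∀ a < s.reg 1, s'.arr ks a = ((g a).find? fun j => s'.arr kF j = 0).getD (s.reg 2 + a)) ∧
      t ≤ s.reg 1 * (L * 9 + 28) + 8 := by
  simp only [choices, wp_seq, wp_copy]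
  refine (wp_firstChoices h0F h0f hFf (s := s.setReg 14 (s.reg 4)) hr hpos hF).mono ?_
  rintro s₁ t₁ hf₁ ⟨h₁, h₂, ht₁⟩
  have a1 := hf₁.reg 1 rfl
  have a2 := hf₁.reg 2 rfl
  have a14 := hf₁.reg 14 rfl
  have a0 := hf₁.arr 0 (by simp [firstChoices, Prog.forUp, Prog.setsArr, h0F, h0f])
  simp only [Store.setReg_reg, Store.setReg_arr, Nat.reduceEqDiff, if_true, if_false,
    OfNat.one_ne_ofNat] at *
  refine (wp_secondChoices (kF := kF) h0s hFs (s := s₁.setReg 4 (s₁.reg 14)) (off := off) (g := g)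
    (L := L) ?_ ?_ ?_).mono ?_
  · simpa [a0, a1] using hr
  · simp [a14, hpos]
  · simpa [a1] using hL
  rintro s₂ t₂ hf₂ ⟨h₃, h₄, ht₂⟩
  have bF := hf₂.arr kF (by simp [secondChoices, Prog.forUp, Prog.setsArr, hFs.symm])
  have bf := hf₂.arr kf (by simp [secondChoices, Prog.forUp, Prog.setsArr, hfs.symm])
  simp only [Store.setReg_reg, Store.setReg_arr, Nat.reduceEqDiff, if_false,
    OfNat.one_ne_ofNat, a1, a2] at *
  rw [bF, bf]
  refine ⟨h₃, h₁, h₂, h₄, ?_⟩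
  rw [Nat.mul_add] at ht₂ ⊢
  omega

end RAM

namespace RAM

/-! ### The auction

Registers: `14` holds the newest row, `15` the bidding row, `16` is nonzero while the auction is
running, `17` is the price limit and `18` the column of the bid. -/

/-- The adjacency of rows and columns that is represented by the arrays `2` to `7`. -/
def Store.Adj (s : Store) (i j : ℕ) : Prop :=
  if i < s.reg 1 then (j = s.arr 3 i ∨ j = s.arr 4 i) ∧ (j = s.arr 6 i ∨ j = s.arr 7 i)
  else s.arr 2 j = 0 ∧ s.arr 5 j = 0

/-- Set register `v` to `0` iff the column in register `7` is one of the two choices, in arrays `kf`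
and `ks`, of the row in register `15`. -/
def isChoice (kf ks v : ℕ) : Prog :=
  .load 11 kf 15 ⨟ .sub 12 11 7 ⨟ .sub 11 7 11 ⨟ .add 11 11 12 ⨟
  .load v ks 15 ⨟ .sub 12 v 7 ⨟ .sub v 7 v ⨟ .add v v 12 ⨟ .ite 11 .skip (.const v 0)

/-- Set register `9` to `0` iff the row in register `15` is adjacent to the column in
register `7`. -/
def isAdj : Prog :=
  .sub 11 1 15 ⨟
  .ite 11 (isChoice 3 4 9 ⨟ isChoice 6 7 10 ⨟ .add 9 9 10) (.load 9 2 7 ⨟ .load 10 5 7 ⨟ .add 9 9 10)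

/-- Look for an adjacent column of minimum price. -/
def cheapest : Prog :=
  .copy 17 3 ⨟ .const 18 0 ⨟
  .forUp 7 3 8 (isAdj ⨟
    .ite 9 .skip (.load 9 9 7 ⨟ .sub 10 17 9 ⨟ .ite 10 (.copy 17 9 ⨟ .copy 18 7) .skip))

/-- Buy the column in register `18`; its former owner bids next, or else a new row. -/
def buy : Prog :=
  .load 9 8 18 ⨟ .const 10 1 ⨟ .add 11 15 10 ⨟ .store 8 18 11 ⨟ .add 12 17 10 ⨟ .store 9 18 12 ⨟
  .ite 9 (.sub 15 9 10) (.add 14 14 10 ⨟ .copy 15 14 ⨟ .sub 16 3 14)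

def auction : Prog :=
  .const 14 0 ⨟ .const 15 0 ⨟ .const 0 1 ⨟ .copy 16 3 ⨟
  .loop 16 (cheapest ⨟ .sub 9 3 17 ⨟ .ite 9 buy (.const 0 0 ⨟ .const 16 0))

/-- Write the partners of all owners of columns below the number of jobs to array `1`. -/
def output : Prog :=
  .forUp 7 2 8 (.load 9 8 7 ⨟ .const 10 1 ⨟ .sub 9 9 10 ⨟ .add 10 7 10 ⨟ .store 1 9 10)

theorem Frame.adj {P : Prog} {s s' : Store} (h : Frame P s s') (h₁ : P.setsReg 1 = false)
    (h₂ : P.setsArr 2 = false) (h₃ : P.setsArr 3 = false) (h₄ : P.setsArr 4 = false)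
    (h₅ : P.setsArr 5 = false) (h₆ : P.setsArr 6 = false) (h₇ : P.setsArr 7 = false) :
    s'.Adj = s.Adj := by
  unfold Store.Adj
  rw [h.reg 1 h₁, h.arr 2 h₂, h.arr 3 h₃, h.arr 4 h₄, h.arr 5 h₅, h.arr 6 h₆, h.arr 7 h₇]

/-- Equality is tested through truncated subtraction: `(x - y) + (y - x)` is zero iff `x = y`. -/
theorem wp_isChoice {kf ks v : ℕ} (h₇ : v ≠ 7) (h₁₁ : v ≠ 11) (h₁₂ : v ≠ 12) (s : Store) :
    wp (isChoice kf ks v) s fun s' t =>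
      (s'.reg v = 0 ↔ s.reg 7 = s.arr kf (s.reg 15) ∨ s.reg 7 = s.arr ks (s.reg 15)) ∧ t ≤ 11 := by
  simp only [isChoice, wp_seq, wp_load, wp_const, wp_add, wp_sub, wp_skip, wp_ite,
      Store.setReg_reg, Store.setReg_arr, Nat.reduceEqDiff,
      if_true, if_false, h₇.symm, h₁₁.symm, h₁₂, h₁₂.symm]
  split_ifs
  · exact ⟨iff_of_true trivial (by omega), by omega⟩
  · exact ⟨by omega, by omega⟩

theorem wp_isAdj (s : Store) :
    wp isAdj s fun s' t => (s'.reg 9 = 0 ↔ s.Adj (s.reg 15) (s.reg 7)) ∧ t ≤ 26 := by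
  simp only [isAdj, wp_seq, wp_sub, wp_ite]
  split_ifs with h
  · simp only [wp_load, wp_add, Store.setReg_reg, Store.setReg_arr, Nat.reduceEqDiff,
      if_true, if_false] at h ⊢
    rw [Store.Adj, if_neg (by omega)]
    omega
  · refine (wp_isChoice (by decide) (by decide) (by decide) _).mono ?_
    rintro s₁ t₁ hf₁ ⟨h₁, ht₁⟩
    refine (wp_isChoice (by decide) (by decide) (by decide) _).mono ?_
    rintro s₂ t₂ hf₂ ⟨h₂, ht₂⟩
    have a7 := hf₁.reg 7 rfl
    have a15 := hf₁.reg 15 rfl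
    have a6 := hf₁.arr 6 rfl
    have a7' := hf₁.arr 7 rfl
    have b9 := hf₂.reg 9 rfl
    simp only [wp_add, Store.setReg_reg, Store.setReg_arr, Nat.reduceEqDiff,
      if_true, if_false] at *
    rw [a7, a15, a6, a7'] at h₂
    rw [Store.Adj, if_pos (by omega), ← h₁, ← h₂, b9]
    omega

/-- The running minimum starts at the price limit and only strictly cheaper columns replace it, so a
final value equal to the limit means that no adjacent column may still be bought. -/
theorem wp_cheapest (s : Store) :
    wp cheapest s fun s' t => s'.reg 17 ≤ s.reg 3 ∧
      (∀ j < s.reg 3, s.Adj (s.reg 15) j → s'.reg 17 ≤ s.arr 9 j) ∧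
      (s'.reg 17 < s.reg 3 → s'.reg 18 < s.reg 3 ∧ s.Adj (s.reg 15) (s'.reg 18) ∧
        s.arr 9 (s'.reg 18) = s'.reg 17) ∧ t ≤ s.reg 3 * 40 + 5 := by
  simp only [cheapest, wp_seq, wp_copy, wp_const]
  refine (wp_forUp (fun k s' => s'.reg 17 ≤ s.reg 3 ∧
      (∀ j < k, s.Adj (s.reg 15) j → s'.reg 17 ≤ s.arr 9 j) ∧
      (s'.reg 17 < s.reg 3 → s'.reg 18 < k ∧ s.Adj (s.reg 15) (s'.reg 18) ∧
        s.arr 9 (s'.reg 18) = s'.reg 17)) 36 (by decide) (by decide) (by decide) rfl rfl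
      ?_ ?_ ?_).mono ?_
  · intro k s v w h
    simpa using h
  · simp
  · rintro k s₁ hk hi hf ⟨h₁, h₂, h₃⟩
    have hadj : s₁.Adj = s.Adj := hf.adj rfl rfl rfl rfl rfl rfl rfl
    have e15 := hf.reg 15 rfl
    have e9 := hf.arr 9 rfl
    rw [wp_seq]
    refine (wp_isAdj s₁).mono ?_
    rintro s₂ t₂ hf₂ ⟨ha, ht₂⟩
    have f17 := hf₂.reg 17 rfl
    have f18 := hf₂.reg 18 rfl
    have f7 := hf₂.reg 7 rfl
    have f9 := hf₂.arr 9 rfl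
    simp only [Store.setReg_reg, Store.setReg_arr, Nat.reduceEqDiff, if_false] at e15 e9 hk
    rw [hadj, e15, hi] at ha
    simp only [wp_ite, wp_seq, wp_load, wp_sub, wp_copy, wp_skip, Store.setReg_reg,
      Nat.reduceEqDiff, if_true, if_false, Nat.forall_lt_succ_right,
      f17, f18, f7, f9, e9, hi]
    split_ifs with h9 hlt
    · refine ⟨⟨h₁, ⟨h₂, fun _ => by omega⟩, fun h => ?_⟩, by omega⟩
      have := h₃ h
      exact ⟨by omega, this.2⟩
    · refine ⟨⟨by omega, ⟨fun j hj hA => ?_, fun _ => le_rfl⟩, fun h =>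
        ⟨by omega, ha.1 h9, trivial⟩⟩, by omega⟩
      have := h₂ j hj hA
      omega
    · refine ⟨⟨h₁, ⟨h₂, fun h => absurd (ha.2 h) h9⟩, fun h => ?_⟩, by omega⟩
      have := h₃ h
      exact ⟨by omega, this.2⟩
  · rintro s₂ t₂ - ⟨⟨h₁, h₂, h₃⟩, ht⟩
    simp only [Store.setReg_reg, Nat.reduceEqDiff, if_false] at *
    exact ⟨h₁, h₂, h₃, by omega⟩

/-- The state of a running auction. -/
structure Bidding (E : ℕ → ℕ → Prop) (s : Store) : Prop where
  auction : Auction (s.reg 3) E (s.arr 8) (s.arr 9)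
  owns : ∀ i, Owns (s.reg 3) (s.arr 8) i ↔ i ≤ s.reg 14 ∧ i ≠ s.reg 15
  cur_le : s.reg 15 ≤ s.reg 14
  lt : s.reg 14 < s.reg 3

theorem wp_buy {E : ℕ → ℕ → Prop} {s : Store} (h : Bidding E s) (hres : s.reg 0 = 1)
    (hgo : s.reg 16 ≠ 0)
    (hmin : ∀ j < s.reg 3, E (s.reg 15) j → s.reg 17 ≤ s.arr 9 j)
    (hbest : s.reg 18 < s.reg 3) (hE : E (s.reg 15) (s.reg 18))
    (hd : s.arr 9 (s.reg 18) = s.reg 17) (hlt : s.reg 17 < s.reg 3) :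
    wp buy s fun s' t => s'.reg 0 = 1 ∧ (s'.reg 16 ≠ 0 → Bidding E s' ∧
        ∑ j ∈ Finset.range (s.reg 3), s'.arr 9 j = (∑ j ∈ Finset.range (s.reg 3), s.arr 9 j) + 1) ∧
      (s'.reg 16 = 0 → IsPerfect (s.reg 3) E (s'.arr 8)) ∧ t ≤ 10 := by
  have hcur : ¬ Owns (s.reg 3) (s.arr 8) (s.reg 15) := fun h' => ((h.owns _).1 h').2 rfl
  have hA := h.auction.bid hcur hbest hE (by omega) (fun j hj hj' => hd ▸ hmin j hj hj')
  have hO := fun i => (h.auction.owns_bid (i := s.reg 15) hbest i).trans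
    (or_congr_right (and_congr_left' (h.owns i)))
  have hsum := Auction.sum_update hbest (s.arr 9)
  rw [hd] at hA hsum
  have hle := h.cur_le
  have hltN := h.lt
  simp only [buy, wp_ite, wp_seq, wp_load, wp_sub, wp_copy, wp_const, wp_add, wp_store,
    Store.setReg_reg, Store.setReg_arr, Store.setArr_reg, Store.setArr_arr, Nat.reduceEqDiff,
    if_true, if_false]
  split_ifs with h0
  -- The column was free, so nobody is evicted: all rows up to the newest now own one, and a new row
  -- enters unless there is none left.
  · have hO' : ∀ i, Owns (s.reg 3) (Function.update (s.arr 8) (s.reg 18) (s.reg 15 + 1)) i ↔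
        i ≤ s.reg 14 := by
      intro i
      rw [hO, h0]
      omega
    refine ⟨hres, fun hgo' => ⟨⟨?_, ?_, ?_, ?_⟩, hsum⟩, fun hgo' i hi => ?_, by omega⟩
    · simpa using hA
    · simp only [Store.setReg_reg, Store.setReg_arr, Store.setArr_reg, Store.setArr_arr,
        Nat.reduceEqDiff, if_true, if_false]
      intro i
      rw [hO']
      omega
    · simp
    · simp only [Store.setReg_reg, Store.setArr_reg, Nat.reduceEqDiff, if_true, if_false]
      omega
    · obtain ⟨j, hj, hij⟩ := (hO' i).2 (by omega)
      exact ⟨j, hj, hij, hA.adj j hj i hij⟩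
  -- The evicted owner becomes the bidder; it had already entered the auction.
  · have hprev := (h.owns (s.arr 8 (s.reg 18) - 1)).1 ⟨_, hbest, by omega⟩
    refine ⟨hres, fun hgo' => ⟨⟨?_, ?_, ?_, ?_⟩, hsum⟩, fun hgo' => absurd hgo' hgo, by omega⟩
    · simpa using hA
    · simp only [Store.setReg_reg, Store.setReg_arr, Store.setArr_reg, Store.setArr_arr,
        Nat.reduceEqDiff, if_true, if_false]
      intro i
      rw [hO]
      omega
    · simpa using hprev.1
    · simpa using hltN

theorem wp_auction {s : Store} (h8 : s.arr 8 = fun _ => 0) (h9 : s.arr 9 = fun _ => 0) :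
    wp auction s fun s' t =>
      (s'.reg 0 = 1 ∧ IsPerfect (s.reg 3) s.Adj (s'.arr 8) ∨
        s'.reg 0 = 0 ∧ ¬ HasPerfectMatching (s.reg 3) s.Adj) ∧
      t ≤ (s.reg 3 * s.reg 3 + 1) * (s.reg 3 * 40 + 21) + 5 := by
  classical
  simp only [auction, wp_seq, wp_const, wp_copy]
  refine (wp_loop (fun s' => (s'.reg 16 ≠ 0 → s'.reg 0 = 1 ∧ Bidding s.Adj s') ∧
      (s'.reg 16 = 0 → (s'.reg 0 = 1 ∧ IsPerfect (s.reg 3) s.Adj (s'.arr 8) ∨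
        s'.reg 0 = 0 ∧ ¬ HasPerfectMatching (s.reg 3) s.Adj)))
      -- While the auction runs this is positive by `sum_le`, because of the `+ 1`; so it also
      -- decreases when the flag is cleared.
      (fun s' => if s'.reg 16 = 0 then 0 else
        s.reg 3 * s.reg 3 + 1 - ∑ j ∈ Finset.range (s.reg 3), s'.arr 9 j)
      (s.reg 3 * 40 + 20) ?_ ?_).mono ?_
  · simp only [Store.setReg_reg, Store.setReg_arr, Nat.reduceEqDiff, if_true, if_false,
      OfNat.zero_ne_ofNat]
    -- The flag is initially zero only if there are no rows, where the answer `1` is correct.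
    refine ⟨fun h => ⟨trivial, ?_, ?_, ?_, ?_⟩, fun h => Or.inl ⟨trivial, ?_⟩⟩
    · simpa [h8, h9] using Auction.start
    · intro i
      simp [Owns, h8]
    · simp
    · simpa using Nat.pos_of_ne_zero h
    · intro i hi
      omega
  · rintro s₁ ⟨hgo, -⟩ hf hx
    obtain ⟨hres, hB⟩ := hgo hx
    have e3 := hf.reg 3 rfl
    have hadj : s₁.Adj = s.Adj := by
      rw [hf.adj rfl rfl rfl rfl rfl rfl rfl]
      rfl
    simp only [Store.setReg_reg, Nat.reduceEqDiff, if_false] at e3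
    rw [wp_seq]
    refine (wp_cheapest s₁).mono ?_
    rintro s₂ t₂ hf₂ ⟨h₁, h₂, h₃, ht₂⟩
    have f0 := hf₂.reg 0 rfl
    have f3 := hf₂.reg 3 rfl
    have f14 := hf₂.reg 14 rfl
    have f15 := hf₂.reg 15 rfl
    have f16 := hf₂.reg 16 rfl
    have f8 := hf₂.arr 8 rfl
    have f9 := hf₂.arr 9 rfl
    have hsle := hB.auction.sum_le
    rw [hadj, e3] at h₂ h₃
    rw [e3] at h₁ f3 ht₂ hsle
    simp only [wp_seq, wp_sub, wp_ite, wp_const, Store.setReg_reg, Store.setReg_arr,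
      Nat.reduceEqDiff, if_true, if_false, f3]
    split_ifs with h9'
    · refine ⟨⟨fun h => absurd rfl h, fun _ => Or.inr ⟨trivial, ?_⟩⟩, by omega, by omega⟩
      have hlt := hB.lt
      have hle := hB.cur_le
      have hA := hB.auction
      have hO := hB.owns
      rw [e3] at hlt hA hO
      refine hA.not_hasPerfectMatching (i := s₁.reg 15) (fun j hj => ?_) (by omega)
        (fun h => ((hO _).1 h).2 rfl) (fun j hj hE => ?_)
      · by_contra hlt'
        have := (hO (s₁.arr 8 j - 1)).1 ⟨j, hj, by omega⟩
        omega
      · have := h₂ j hj hE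
        omega
    · obtain ⟨h₄, h₅, h₆⟩ := h₃ (by omega)
      have hB' : Bidding s.Adj (s₂.setReg 9 (s.reg 3 - s₂.reg 17)) := by
        constructor
        · simpa [f3, f8, f9, ← e3] using hB.auction
        · simpa [f3, f8, f14, f15, ← e3] using hB.owns
        · simpa [f14, f15] using hB.cur_le
        · simpa [f14, f3, ← e3] using hB.lt
      refine (wp_buy hB' ?_ ?_ ?_ ?_ ?_ ?_ ?_).mono ?_
      · simpa [f0] using hres
      · simpa [f16] using hx
      · simpa [f3, f15, f9] using h₂
      · simpa [f3] using h₄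
      · simpa [f15] using h₅
      · simpa [f9] using h₆
      · simp [f3]; omega
      · rintro s₃ t₃ hf₃ ⟨h₁', h₂', h₃', ht₃⟩
        simp only [Store.setReg_reg, Store.setReg_arr, Nat.reduceEqDiff, if_false, f3, f9] at *
        refine ⟨⟨fun h => ⟨h₁', (h₂' h).1⟩, fun h => Or.inl ⟨h₁', h₃' h⟩⟩, ?_, by omega⟩
        split_ifs with h
        · omega
        · rw [(h₂' h).2]
          omega
  · rintro s₁ t₁ - ⟨⟨-, h⟩, h0, ht⟩
    refine ⟨h h0, ?_⟩
    have : (if s.reg 3 = 0 then 0 else s.reg 3 * s.reg 3 + 1 -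
        ∑ j ∈ Finset.range (s.reg 3), s.arr 9 j) ≤ s.reg 3 * s.reg 3 + 1 := by
      split_ifs <;> omega
    have := Nat.mul_le_mul_right (s.reg 3 * 40 + 21) this
    simp only [Store.setReg_reg, Store.setReg_arr, Nat.reduceEqDiff, if_true, if_false] at ht
    rw [show s.reg 3 * 40 + 20 + 1 = s.reg 3 * 40 + 21 from rfl] at ht
    omega

/-- The map `σ` certifies that different jobs have different owners, so no cell is written twice.
Cells never written keep `0`, the code of an unmatched applicant. -/
theorem wp_output {s : Store} {σ : ℕ → ℕ} (h1 : s.arr 1 = fun _ => 0)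
    (hown : ∀ j < s.reg 2, ∃ i, σ i = j ∧ s.arr 8 j = i + 1) :
    wp output s fun s' t =>
      (∀ j < s.reg 2, s'.arr 1 (s.arr 8 j - 1) = j + 1) ∧
      (∀ i, (∀ j < s.reg 2, s.arr 8 j ≠ i + 1) → s'.arr 1 i = 0) ∧ t ≤ s.reg 2 * 9 + 3 := by
  refine (wp_forUp (fun k s' => (∀ j < k, s'.arr 1 (s.arr 8 j - 1) = j + 1) ∧
      (∀ i, (∀ j < k, s.arr 8 j ≠ i + 1) → s'.arr 1 i = 0)) 5 (by decide) (by decide)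
      (by decide) rfl rfl ?_ ?_ ?_).mono fun s' t _ h => ⟨h.1.1, h.1.2, h.2⟩
  · intro k s v w h
    simpa using h
  · simp [h1]
  · rintro k s₁ hk hi hf ⟨h₁, h₂⟩
    have e8 := hf.arr 8 rfl
    obtain ⟨i, hik, hki⟩ := hown k hk
    simp only [wp_seq, wp_load, wp_const, wp_sub, wp_add, wp_store, Store.setReg_reg,
      Store.setReg_arr, Store.setArr_arr, Nat.reduceEqDiff, if_true, if_false, e8, hi, hki,
      Nat.forall_lt_succ_right, Nat.add_sub_cancel, Function.update_self]
    refine ⟨⟨⟨fun j hj => ?_, trivial⟩, fun i' hi' => ?_⟩, by omega⟩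
    · rw [Function.update_of_ne, h₁ j hj]
      intro he
      obtain ⟨i', hij', hji'⟩ := hown j (by omega)
      rw [hji'] at he
      have : i' = i := by omega
      subst this
      omega
    · rw [Function.update_of_ne (by omega)]
      exact h₂ i' hi'.1

end RAM

/-! ### From the encoded input to the whole program -/

namespace RAM

/-- The item at position `p + i` of the memory is item `i` of the list. -/
def Holds (mem : ℕ → ℕ) (p : ℕ) (l : List ℕ) : Prop := ∀ i (h : i < l.length), mem (p + i) = l[i]

theorem Holds.append {mem : ℕ → ℕ} {p : ℕ} {l l' : List ℕ} (h : Holds mem p (l ++ l')) :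
    Holds mem p l ∧ Holds mem (p + l.length) l' := by
  constructor
  · intro i hi
    rw [h i (by simp; omega), List.getElem_append_left hi]
  · intro i hi
    rw [Nat.add_assoc, h (l.length + i) (by simpa using hi), List.getElem_append_right (by omega)]
    simp

/-- A row begins after the encodings of the rows before it; splitting the list there isolates its
own block. -/
theorem Holds.rows {mem : ℕ → ℕ} {p : ℕ} {rows : List (List ℕ)}
    (h : Holds mem p (rows.flatMap fun l => l.length :: l)) :
    Rows mem (fun a => p + ((rows.take a).flatMap fun l => l.length :: l).length)
      (fun a => rows.getD a []) rows.length := by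
  have key : ∀ a (ha : a < rows.length),
      Holds mem (p + ((rows.take a).flatMap fun l => l.length :: l).length)
        (rows[a].length :: rows[a]) := by
    intro a ha
    rw [← List.take_append_drop a rows, List.drop_eq_getElem_cons ha, List.flatMap_append,
      List.flatMap_cons] at h
    exact h.append.2.append.1
  constructor
  · intro a ha
    have := key a ha 0 (by simp)
    simpa [List.getElem?_eq_getElem ha] using this
  · intro a ha i hi
    simp only [List.getD_eq_getElem _ _ ha] at hi ⊢
    have := key a ha (i + 1) (by simpa using hi)
    rw [Nat.add_right_comm]
    simpa [Nat.add_assoc] using this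
  · intro a ha
    simp only [List.take_succ_eq_append_getElem ha, List.flatMap_append, List.length_append,
      List.getD_eq_getElem _ _ ha]
    simp
    omega

open OneSidedInstance

variable {nA nB : ℕ}

/-- The arrays `kF`, `kf` and `ks` hold the marks of first choices, the first choices and the second
choices of an instance. -/
structure HoldsChoices (I : OneSidedInstance (Fin nA) (Fin nB)) (s : Store) (kF kf ks : ℕ) :
    Prop where
  top : ∀ j, s.arr kF j = 0 ↔ ∀ b : Fin nB, j = b → ¬ I.IsTop b
  first : ∀ a : Fin nA, s.arr kf a = outcomeCode a (I.pref a).head?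
  second : ∀ a : Fin nA, s.arr ks a = outcomeCode a (I.second a)

theorem HoldsChoices.congr {I : OneSidedInstance (Fin nA) (Fin nB)} {s s' : Store} {kF kf ks : ℕ}
    (h : HoldsChoices I s kF kf ks) (hF : s'.arr kF = s.arr kF) (hf : s'.arr kf = s.arr kf)
    (hs : s'.arr ks = s.arr ks) : HoldsChoices I s' kF kf ks := by
  constructor
  · rw [hF]; exact h.top
  · rw [hf]; exact h.first
  · rw [hs]; exact h.second

theorem outcomeCode_eq_getD (a : Fin nA) (x : Option (Fin nB)) :
    outcomeCode a x = (x.map Fin.val).getD (nB + a) := by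
  cases x <;> rfl

theorem wp_choices_instance (I : OneSidedInstance (Fin nA) (Fin nB)) {kF kf ks : ℕ} (h0F : kF ≠ 0)
    (h0f : kf ≠ 0) (h0s : ks ≠ 0) (hFf : kF ≠ kf) (hFs : kF ≠ ks) (hfs : kf ≠ ks) {s : Store}
    (hA : s.reg 1 = nA) (hB : s.reg 2 = nB) (hI : Holds (s.arr 0) (s.reg 4) I.encodePrefs)
    (hF : ∀ j, s.arr kF j = 0) :
    wp (choices kF kf ks) s fun s' t => s'.reg 4 = s.reg 4 + I.encodePrefs.length ∧
      HoldsChoices I s' kF kf ks ∧ t ≤ nA * (I.totalLength * 9 + 28) + 8 := by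
  classical
  set rows := (List.finRange nA).map fun a => (I.pref a).map Fin.val with hrows
  have henc : I.encodePrefs = rows.flatMap fun l => l.length :: l := by
    simp [encodePrefs, hrows, List.flatMap_map]
  have hlen : rows.length = nA := by simp [hrows]
  have hg : ∀ a : Fin nA, rows.getD a [] = (I.pref a).map Fin.val := by
    intro a
    rw [List.getD_eq_getElem _ _ (hlen.symm ▸ a.2)]
    simp [hrows]
  rw [henc] at hI ⊢
  have hr := hI.rows
  rw [hlen, ← hA] at hr
  refine (wp_choices h0F h0f h0s hFf hFs hfs hr (by simp) hF (L := I.totalLength) ?_).mono ?_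
  · intro a ha
    rw [hA] at ha
    have := hg ⟨a, ha⟩
    simp only at this
    rw [this, List.length_map]
    exact Finset.single_le_sum (f := fun a => (I.pref a).length) (fun _ _ => Nat.zero_le _)
      (Finset.mem_univ _)
  rintro s' t - ⟨h₁, h₂, h₃, h₄, ht⟩
  rw [hA] at h₁ h₂ h₃ h₄ ht
  rw [hB] at h₃ h₄
  have htop : ∀ j, s'.arr kF j = 0 ↔ ∀ b : Fin nB, j = b → ¬ I.IsTop b := by
    intro j
    rw [h₂]
    constructor
    · rintro h b rfl ⟨a, ha⟩
      refine h a a.2 ?_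
      rw [hg, List.head?_map, ha]
      rfl
    · intro h a ha ha'
      have := hg ⟨a, ha⟩
      simp only at this
      rw [this, List.head?_map, Option.map_eq_some_iff] at ha'
      obtain ⟨b, hb, rfl⟩ := ha'
      exact h b rfl ⟨_, hb⟩
  refine ⟨?_, ⟨htop, fun a => ?_, fun a => ?_⟩, ht⟩
  · rw [h₁, List.take_of_length_le hlen.le]
  · rw [h₃ a a.2, hg, List.head?_map, outcomeCode_eq_getD]
  · rw [h₄ a a.2, hg, List.find?_map, outcomeCode_eq_getD]
    congr 3
    funext b
    simp only [Function.comp_apply, htop, decide_eq_decide]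
    exact ⟨fun h => h b rfl, fun h b' hb' => Fin.ext hb' ▸ h⟩

theorem HoldsChoices.adj {I I' : OneSidedInstance (Fin nA) (Fin nB)} {s : Store}
    (h : HoldsChoices I s 2 3 4) (h' : HoldsChoices I' s 5 6 7) (hA : s.reg 1 = nA) :
    s.Adj = I.RobustAdj I' := by
  funext i j
  unfold Store.Adj RobustAdj
  rw [hA]
  split_ifs with hi
  · rw [← h.first, ← h.second, ← h'.first, ← h'.second]
  · rw [h.top, h'.top, ← forall_and]
    exact propext (forall_congr' fun b => imp_and.symm)

/-- Decide the existence of a robust popular matching, and write one to array `1`. -/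
def robustPopular : Prog :=
  .const 9 0 ⨟ .load 1 0 9 ⨟ .const 9 1 ⨟ .load 2 0 9 ⨟ .add 3 1 2 ⨟ .const 4 2 ⨟
  choices 2 3 4 ⨟ choices 5 6 7 ⨟ auction ⨟ .ite 0 output .skip

theorem wp_robustPopular (I I' : OneSidedInstance (Fin nA) (Fin nB))
    (hadj : ∀ a b, I.Adj a b ↔ I'.Adj a b) :
    wp robustPopular (init (I.encodePair I')) fun s t =>
      (s.reg 0 = 1 ∧ (∃ M, I.IsRobustPopular I' M ∧ ∀ a : Fin nA, s.arr 1 a = encodePartner (M a)) ∨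
        s.reg 0 = 0 ∧ ¬ ∃ M, I.IsRobustPopular I' M) ∧
      t ≤ nA * (I.totalLength * 9 + 28) + nA * (I'.totalLength * 9 + 28) +
        ((nA + nB) * (nA + nB) + 1) * ((nA + nB) * 40 + 21) + nB * 9 + 100 := by
  have hinit : Holds ((init (I.encodePair I')).arr 0) 0 (I.encodePair I') := by
    intro i hi
    simp only [init, if_true, Nat.zero_add]
    exact List.getD_eq_getElem _ _ hi
  have h0 : (init (I.encodePair I')).arr 0 0 = nA := rfl
  have h1 : (init (I.encodePair I')).arr 0 1 = nB := rfl
  -- Zero is the right start for marks, owners, prices and output, so the program clears no array.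
  have harr : ∀ k, k ≠ 0 → (init (I.encodePair I')).arr k = fun _ => 0 := by
    intro k hk
    simp [init, hk]
  obtain ⟨-, hinit⟩ := Holds.append (l := [nA, nB]) hinit
  obtain ⟨hI, hI'⟩ := hinit.append
  simp only [List.length_cons, List.length_nil, Nat.zero_add] at hI hI'
  generalize init (I.encodePair I') = s at *
  simp only [robustPopular, wp_seq, wp_const, wp_load, wp_add, Store.setReg_reg, Store.setReg_arr,
    Nat.reduceEqDiff, if_true, if_false, h0, h1]
  refine (wp_choices_instance I (by decide) (by decide) (by decide) (by decide) (by decide)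
    (by decide) (by simp) (by simp) (by simpa using hI) (by simp [harr])).mono ?_
  rintro s₁ t₁ hf₁ ⟨h4, hc, ht₁⟩
  have a0 := hf₁.arr 0 rfl
  have a1 := hf₁.arr 1 rfl
  have a5 := hf₁.arr 5 rfl
  have a8 := hf₁.arr 8 rfl
  have a9 := hf₁.arr 9 rfl
  have r1 := hf₁.reg 1 rfl
  have r2 := hf₁.reg 2 rfl
  have r3 := hf₁.reg 3 rfl
  simp only [Store.setReg_reg, Store.setReg_arr, Nat.reduceEqDiff, if_true, if_false,
    OfNat.one_ne_ofNat, harr, ne_eq, OfNat.ofNat_ne_zero, one_ne_zero, not_false_eq_true]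
    at a0 a1 a5 a8 a9 r1 r2 r3 h4
  refine (wp_choices_instance I' (by decide) (by decide) (by decide) (by decide) (by decide)
    (by decide) r1 r2 (by rw [a0, h4]; exact hI') (by simp [a5])).mono ?_
  rintro s₂ t₂ hf₂ ⟨-, hc', ht₂⟩
  have b1 := (hf₂.arr 1 rfl).trans a1
  have b8 := (hf₂.arr 8 rfl).trans a8
  have b9 := (hf₂.arr 9 rfl).trans a9
  have q1 := (hf₂.reg 1 rfl).trans r1
  have q2 := (hf₂.reg 2 rfl).trans r2
  have q3 := (hf₂.reg 3 rfl).trans r3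
  have hE := (hc.congr (hf₂.arr 2 rfl) (hf₂.arr 3 rfl) (hf₂.arr 4 rfl)).adj hc' q1
  refine (wp_auction b8 b9).mono ?_
  rintro s₃ t₃ hf₃ ⟨hres, ht₃⟩
  have c1 := (hf₃.arr 1 rfl).trans b1
  have p2 := (hf₃.reg 2 rfl).trans q2
  rw [hE, q3] at hres
  rw [q3] at ht₃
  rw [wp_ite]
  rcases hres with ⟨hres, hperf⟩ | ⟨hres, hno⟩
  · rw [if_neg (by omega)]
    obtain ⟨σ, ⟨hσ, hinj⟩, hown⟩ := hperf.hasPerfectMatching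
    refine (wp_output (σ := σ) c1 fun j hj => ?_).mono ?_
    · rw [p2] at hj
      obtain ⟨i, -, h⟩ := hown j (by omega)
      exact ⟨i, h⟩
    rintro s₄ t₄ hf₄ ⟨ho₁, ho₂, ht₄⟩
    rw [p2] at ho₁ ho₂ ht₄
    refine ⟨Or.inl ⟨(hf₄.reg 0 rfl).trans hres, ?_⟩, by omega⟩
    refine ⟨fun a => if h : σ a < nB then some ⟨σ a, h⟩ else none,
      isRobustPopular_of_perfect hadj hσ hinj fun a => ?_, fun a => ?_⟩
    -- A column beyond the jobs that is adjacent to an applicant's row can only be her own last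
    -- resort.
    · split_ifs with h
      · rfl
      · have ha := a.2
        have := (hσ a (by omega)).2
        rw [RobustAdj, dif_pos ha] at this
        rcases this.1 with h' | h' <;> rw [h'] at h ⊢
        · rcases hx : (I.pref a).head? with _ | b
          · rfl
          · simp [hx, outcomeCode] at h
        · rcases hx : I.second a with _ | b
          · rfl
          · simp [hx, outcomeCode] at h
    · have ha := a.2
      dsimp only
      split_ifs with h
      · obtain ⟨i, hi, hσi, hoi⟩ := hown (σ a) (hσ a (by omega)).1
        have := ho₁ (σ a) h
        obtain rfl : i = a := hinj (by simpa using hi) (by simp; omega) hσi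
        rw [hoi, Nat.add_sub_cancel] at this
        rw [this]
        rfl
      · rw [ho₂ a fun j hj hja => ?_]
        · rfl
        · obtain ⟨i, -, hσi, hoi⟩ := hown j (by omega)
          have : i = a := by omega
          rw [this] at hσi
          omega
  · rw [if_pos hres, wp_skip]
    exact ⟨Or.inr ⟨hres, fun ⟨M, hM⟩ => hno hM.hasPerfectMatching⟩, by omega⟩

end RAM

/-- One fixed program, whose number of steps is bounded by a polynomial in the number of agents
plus the total length of the preference lists, decides for every perturbed pair whether a robust
popular matching exists (answer `1` or `0` in register `0`), and if so writes one to array `1`. -/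
theorem mainTheorem6 :
    ∃ (P : RAM.Prog) (p : Polynomial ℕ),
      ∀ (nA nB : ℕ) (I I' : OneSidedInstance (Fin nA) (Fin nB)), I.IsPerturbation I' →
        ∃ (s : RAM.Store) (t : ℕ),
          RAM.Exec P (RAM.init (I.encodePair I')) s t ∧
          t ≤ p.eval (nA + nB + I.totalLength + I'.totalLength) ∧
          ((∃ M, I.IsRobustPopular I' M) → s.reg 0 = 1) ∧
          ((¬ ∃ M, I.IsRobustPopular I' M) → s.reg 0 = 0) ∧
          ((∃ M, I.IsRobustPopular I' M) →
            ∃ M, I.IsRobustPopular I' M ∧ ∀ a : Fin nA, s.arr 1 a = encodePartner (M a)) := by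
  -- The bound of `wp_robustPopular` with each parameter replaced by the total size; the factor `2`
  -- stands for the two instances.
  refine ⟨RAM.robustPopular, 2 * (.X * (.X * 9 + 28)) + (.X * .X + 1) * (.X * 40 + 21) + .X * 9 + 100,
    fun nA nB I I' hI => ?_⟩
  obtain ⟨s, t, he, hres, ht⟩ := RAM.wp_robustPopular I I' hI.1
  refine ⟨s, t, he, ht.trans ?_, ?_⟩
  · simp only [Polynomial.eval_add, Polynomial.eval_mul, Polynomial.eval_X, Polynomial.eval_ofNat,
      Polynomial.eval_one]
    set x := nA + nB + I.totalLength + I'.totalLength with hx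
    rw [two_mul]
    gcongr <;> omega
  · rcases hres with ⟨h1, hM⟩ | ⟨h0, hno⟩
    · exact ⟨fun _ => h1, fun h => absurd (hM.imp fun _ => And.left) h, fun _ => hM⟩
    · exact ⟨fun h => absurd h hno, fun _ => h0, fun h => absurd h hno⟩
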